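/- Let $f,g:\mathbb{R}^n\to\mathbb{R}\cup\{+\infty\}$ be proper, lower semicontinuous and convex, and put $F:=f+g$, $\mathrm{dom}\,h:=\{x: h(x)<+\infty\}$. Assume that $f$ is standard self-concordant: $\mathrm{dom}\,f$ is open, $f$ is $C^3$ there, and for all $x\in\mathrm{dom}\,f$, $v\in\mathbb{R}^n$ the function $\varphi(t):=f(x+tv)$ satisfies $|\varphi'''(t)|\le 2\varphi''(t)^{3/2}$ whenever $x+tv\in\mathrm{dom}\,f$. For $x\in\mathrm{dom}\,f$ write $\|v\|_x:=(v^T\nabla^2 f(x)v)^{1/2}$. Assume that $x^*$ is the unique minimizer of $F$ (with $x^*\in\mathrm{dom}\,F$) and that $\nabla^2 f(x^*)\succ 0$. Let $\{x^k\}_{k\ge0}$ be generated by the proximal-Newton scheme: $x^0\in\mathrm{dom}\,F$ and, for $k\ge 0$, $$s^k\in\operatorname*{argmin}_{y\in\mathbb{R}^n}\Big\{g(y)+\tfrac12 y^T\nabla^2 f(x^k)y-\big(\nabla^2 f(x^k)x^k-\nabla f(x^k)\big)^Ty\Big\},\qquad x^{k+1}:=x^k+\alpha_k(s^k-x^k),$$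 with $\alpha_k\in(0,1]$, and let $\lambda_k:=\|s^k-x^k\|_{x^k}$. Say that a nonnegative sequence $(u_k)$ converges to $0$ quadratically if $u_k\to0$ and there is a constant $C$ with $u_{k+1}\le Cu_k^2$ for all $k\ge 0$. Then: (a) For every $k$ with $x^k\in\mathrm{dom}\,F$ and $\alpha_k\lambda_k<1-\frac1{\sqrt2}$, one has $x^{k+1}\in\mathrm{dom}\,F$ and $$\lambda_{k+1}\le\left(\frac{1-\alpha_k+(2\alpha_k^2-\alpha_k)\lambda_k}{1-4\alpha_k\lambda_k+2\alpha_k^2\lambda_k^2}\right)\lambda_k .$$ (b) If $\alpha_k=(1+\lambda_k)^{-1}$ for all $k$ and $\lambda_0\le\sqrt5-2$, then $x^k\in\mathrm{dom}\,F$ for all $k$ and $\lambda_k\to0$ quadratically. (c) If $\alpha_k=1$ for all $k$ and $\lambda_0\le\frac{5-\sqrt{17}}4$, then $x^k\in\mathrm{dom}\,F$ for all $k$ and $\lambda_k\to0$ quadratically. In both cases (b) and (c), $\|x^k-x^*\|_{x^*}\to0$ quadratically as well. -/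

import Mathlib

open scoped RealInnerProductSpace Topology

noncomputable section

/-- Euclidean space `ℝⁿ`. -/
abbrev Rn (n : ℕ) : Type := EuclideanSpace ℝ (Fin n)

/-- The effective domain `{x | h x < +∞}` of an extended-real-valued function. -/
def effDom {n : ℕ} (h : Rn n → EReal) : Set (Rn n) := {x | h x < ⊤}

/-- The real-valued representative of an extended-real-valued function; it is meaningful on
the effective domain. -/
def toRealFun {n : ℕ} (h : Rn n → EReal) (x : Rn n) : ℝ := (h x).toReal

/-- `h : ℝⁿ → ℝ ∪ {+∞}` is proper, lower semicontinuous and convex (its epigraph is convex). -/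
structure IsProperClosedConvex {n : ℕ} (h : Rn n → EReal) : Prop where
  ne_bot : ∀ x, h x ≠ ⊥
  nonempty : (effDom h).Nonempty
  lsc : LowerSemicontinuous h
  convex : Convex ℝ {p : Rn n × ℝ | h p.1 ≤ (p.2 : EReal)}

/-- Standard self-concordant functions (parameter `M = 2`): proper, closed, convex, with open
domain, three times continuously differentiable there, and such that every restriction
`φ t = f (x + t v)` to a line satisfies `|φ'''(t)| ≤ 2 φ''(t)^(3/2)` as long as `x + t v`
stays in the domain. -/
structure IsStandardSelfConcordant {n : ℕ} (f : Rn n → EReal) : Prop where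
  closedConvex : IsProperClosedConvex f
  isOpen_dom : IsOpen (effDom f)
  contDiffOn : ContDiffOn ℝ 3 (toRealFun f) (effDom f)
  third_deriv_le : ∀ x ∈ effDom f, ∀ v : Rn n, ∀ t : ℝ, x + t • v ∈ effDom f →
    |iteratedDeriv 3 (fun τ : ℝ => toRealFun f (x + τ • v)) t| ≤
      2 * (iteratedDeriv 2 (fun τ : ℝ => toRealFun f (x + τ • v)) t) ^ (3 / 2 : ℝ)

/-- The gradient `∇f(x)`. -/
def grad {n : ℕ} (f : Rn n → EReal) (x : Rn n) : Rn n := gradient (toRealFun f) x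

/-- The Hessian `∇²f(x)`, as a linear operator on `ℝⁿ`: the derivative of the gradient. -/
def hess {n : ℕ} (f : Rn n → EReal) (x : Rn n) : Rn n →L[ℝ] Rn n := fderiv ℝ (grad f) x

/-- The local norm `‖v‖_x = (vᵀ ∇²f(x) v)^(1/2)`. -/
def localNorm {n : ℕ} (f : Rn n → EReal) (x v : Rn n) : ℝ := √⟪v, hess f x v⟫

/-- `x` is a solution of the composite problem `min F`, `F = f + g`. -/
def IsSolution {n : ℕ} (f g : Rn n → EReal) (x : Rn n) : Prop :=
  x ∈ effDom (f + g) ∧ ∀ y, (f + g) x ≤ (f + g) y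

/-- A point is strongly regular if the Hessian of `f` is positive definite there. -/
def IsStronglyRegular {n : ℕ} (f : Rn n → EReal) (x : Rn n) : Prop :=
  ∀ v : Rn n, v ≠ 0 → 0 < ⟪v, hess f x v⟫

/-- The generalized proximity operator
`P^g_H(u) = argmin_{y ∈ ℝⁿ} { g(y) + (1/2) yᵀ H y - uᵀ y }`, as the set of minimizers. -/
def proxSet {n : ℕ} (g : Rn n → EReal) (H : Rn n →L[ℝ] Rn n) (u : Rn n) : Set (Rn n) :=
  {s | ∀ y, g s + ((1 / 2 * ⟪s, H s⟫ - ⟪u, s⟫ : ℝ) : EReal) ≤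
    g y + ((1 / 2 * ⟪y, H y⟫ - ⟪u, y⟫ : ℝ) : EReal)}

/-- `x` is generated by the proximal-Newton scheme from `x 0 ∈ dom F` with step sizes
`α k ∈ (0, 1]`; `s k` is the solution of the `k`-th proximal subproblem. -/
structure IsProxNewtonSeq {n : ℕ} (f g : Rn n → EReal) (x s : ℕ → Rn n) (α : ℕ → ℝ) :
    Prop where
  init : x 0 ∈ effDom (f + g)
  step_pos : ∀ k, 0 < α k
  step_le_one : ∀ k, α k ≤ 1
  subproblem : ∀ k, s k ∈ proxSet g (hess f (x k)) (hess f (x k) (x k) - grad f (x k))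
  update : ∀ k, x (k + 1) = x k + α k • (s k - x k)

/-- The proximal-Newton decrement `λ_k = ‖s^k - x^k‖_{x^k}`. -/
def decrement {n : ℕ} (f : Rn n → EReal) (x s : ℕ → Rn n) (k : ℕ) : ℝ :=
  localNorm f (x k) (s k - x k)

/-- The (nonnegative) sequence `u` converges to `0` at a quadratic rate. -/
def ConvergesQuadratically (u : ℕ → ℝ) : Prop :=
  Filter.Tendsto u Filter.atTop (𝓝 0) ∧ ∃ C : ℝ, ∀ k, u (k + 1) ≤ C * u k ^ 2

end

/-! Self-concordance bounds `D³f(x)[u,u,u]` by `2‖u‖_x³`. Banach's polarization inequality upgrades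
this to `|D³f(x)[u,v,v]| ≤ 2‖u‖_x‖v‖_x²`, which says how fast the Hessian, tested on `v`, varies
when the point moves along `u`. Integrating gives the standard estimates: `hessForm_line` (local
norms at nearby points are comparable), `add_mem_effDom` (the Dikin ellipsoid lies in the domain),
`abs_fderiv_sub_sub_le` (error of the linearized gradient) and `div_le_fderiv_sub` (strong
monotonicity of the gradient).

The nonsmooth term enters only through variational inequalities at prox points and at the minimizer.
Adding two of them, each tested at the other's point, cancels `g`. For two consecutive subproblems
(`decrement_step_le`) this leaves the linearization error and the change of the Hessian, whence a
rate sharper than the one in (a). For a subproblem and the minimizer (`localNorm_sub_solution_le`)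
it shows that `s k` is within `O(λ²)` of the minimizer.

Both thresholds in (b) and (c) are below `1/4`, where the sharper rate gives `λ_{k+1} ≤ 3λ_k²`. The
bound in (a) would not suffice: its factor equals `1` exactly at each threshold. Finally, `1 - α k ≤
λ_k` transfers the quadratic rate to the iterates. -/

/-! ### Symmetric bilinear and trilinear forms -/

section Forms

variable {E : Type*} [NormedAddCommGroup E]

/-- A symmetric form `A` with `|A v v| ≤ c * B v v` satisfies the corresponding
Cauchy-Schwarz inequality. -/
theorem abs_apply_le_of_abs_diag_le [NormedSpace ℝ E] (A B : E →L[ℝ] E →L[ℝ] ℝ)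
    (hA : ∀ v w, A v w = A w v) (hB : ∀ v w, B v w = B w v) (hB0 : ∀ v, 0 ≤ B v v)
    {c : ℝ} (hc : 0 ≤ c) (h : ∀ v, |A v v| ≤ c * B v v) (v w : E) :
    |A v w| ≤ c * √(B v v) * √(B w w) := by
  -- Polarization identity for `A` at `t v ± w` and parallelogram law for `B`; the discriminant of
  -- this quadratic in `t` is the claim.
  have key : ∀ t : ℝ, 0 ≤ (c / 2 * B v v) * (t * t) + (-A v w) * t + c / 2 * B w w := by
    intro t
    have h1 := (abs_le.1 (h (t • v + w))).2
    have h2 := (abs_le.1 (h (t • v - w))).1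
    simp only [map_add, map_sub, map_smul, add_apply,
      sub_apply, smul_apply, smul_eq_mul,
      hA w v, hB w v] at h1 h2
    linarith
  have hd := discrim_le_zero key
  rw [discrim] at hd
  have hsq : (A v w) ^ 2 ≤ (c * √(B v v) * √(B w w)) ^ 2 := by
    rw [mul_pow, mul_pow, Real.sq_sqrt (hB0 v), Real.sq_sqrt (hB0 w)]
    nlinarith
  exact abs_le_of_sq_le_sq hsq (by positivity)

theorem abs_apply_le_sqrt_mul_sqrt [NormedSpace ℝ E] (B : E →L[ℝ] E →L[ℝ] ℝ)
    (hB : ∀ v w, B v w = B w v) (hB0 : ∀ v, 0 ≤ B v v) (v w : E) :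
    |B v w| ≤ √(B v v) * √(B w w) := by
  have := abs_apply_le_of_abs_diag_le B B hB hB hB0 zero_le_one
    (fun v => by rw [one_mul, abs_of_nonneg (hB0 v)]) v w
  simpa using this

theorem sqrt_diag_add_le [NormedSpace ℝ E] (B : E →L[ℝ] E →L[ℝ] ℝ)
    (hB : ∀ v w, B v w = B w v) (hB0 : ∀ v, 0 ≤ B v v) (v w : E) :
    √(B (v + w) (v + w)) ≤ √(B v v) + √(B w w) := by
  apply Real.sqrt_le_iff.2 ⟨by positivity, ?_⟩
  have h := (abs_le.1 (abs_apply_le_sqrt_mul_sqrt B hB hB0 v w)).2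
  have h1 := Real.sq_sqrt (hB0 v)
  have h2 := Real.sq_sqrt (hB0 w)
  simp only [map_add, add_apply, hB w v]
  nlinarith

theorem sqrt_diag_smul [NormedSpace ℝ E] (B : E →L[ℝ] E →L[ℝ] ℝ) (c : ℝ) (v : E) :
    √(B (c • v) (c • v)) = |c| * √(B v v) := by
  simp only [map_smul, smul_apply, smul_eq_mul]
  rw [← mul_assoc, Real.sqrt_mul (mul_self_nonneg c), Real.sqrt_mul_self_eq_abs]

/-- With `(c, s) = (cos θ, sin θ)` and `k = √3`, the nodes are the angles `θ`, `θ ± 2π/3`, and the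
weights are the Fejér-type squares `((1 + 2 cos 2θ_j)/3)²`. The right side is the polarization at
angle `3θ`, so it is a convex combination of three values of the cubic. -/
theorem cubic_interpolation (A B C D c s k : ℝ) (hk : k ^ 2 = 3) :
    ((3 * c ^ 2 - s ^ 2) / 3) ^ 2 * (A * c ^ 3 + 3 * B * c ^ 2 * s + 3 * C * c * s ^ 2 + D * s ^ 3)
    + ((2 * s ^ 2 + 2 * k * c * s) / 3) ^ 2 * (A * (-c / 2 - k / 2 * s) ^ 3
        + 3 * B * (-c / 2 - k / 2 * s) ^ 2 * (-s / 2 + k / 2 * c)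
        + 3 * C * (-c / 2 - k / 2 * s) * (-s / 2 + k / 2 * c) ^ 2 + D * (-s / 2 + k / 2 * c) ^ 3)
    + ((2 * s ^ 2 - 2 * k * c * s) / 3) ^ 2 * (A * (-c / 2 + k / 2 * s) ^ 3
        + 3 * B * (-c / 2 + k / 2 * s) ^ 2 * (-s / 2 - k / 2 * c)
        + 3 * C * (-c / 2 + k / 2 * s) * (-s / 2 - k / 2 * c) ^ 2 + D * (-s / 2 - k / 2 * c) ^ 3)
    = (A * (c ^ 3 - 3 * c * s ^ 2) + B * (3 * c ^ 2 * s - s ^ 3)) * (c ^ 2 + s ^ 2) ^ 2 := by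
  grind

/-- A binary cubic form bounded by `M` on the unit circle has all its polarizations
`p(u, e₁, e₁)`, with `u` on the unit circle, bounded by `M`. -/
theorem binary_cubic_polarization_le {A B C D M a b : ℝ}
    (h : ∀ c s : ℝ, c ^ 2 + s ^ 2 = 1 →
      |A * c ^ 3 + 3 * B * c ^ 2 * s + 3 * C * c * s ^ 2 + D * s ^ 3| ≤ M)
    (hab : a ^ 2 + b ^ 2 = 1) : |A * a + B * b| ≤ M := by
  -- `c + i s` is a cube root of `a + i b` on the unit circle.
  obtain ⟨c, s, hcs, rfl, rfl⟩ : ∃ c s : ℝ, c ^ 2 + s ^ 2 = 1 ∧ a = c ^ 3 - 3 * c * s ^ 2 ∧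
      b = 3 * c ^ 2 * s - s ^ 3 := by
    set z : ℂ := ⟨a, b⟩
    have hn : ‖z‖ = 1 := by
      rw [Complex.norm_def, Complex.normSq_apply, ← pow_two, ← pow_two, hab, Real.sqrt_one]
    have hz : z ≠ 0 := by
      intro h0
      rw [h0] at hn
      simp at hn
    have hcos : Real.cos z.arg = a := by rw [Complex.cos_arg hz, hn, div_one]
    have hsin : Real.sin z.arg = b := by rw [Complex.sin_arg, hn, div_one]
    have h3 : z.arg = 3 * (z.arg / 3) := by ring
    have hone := Real.cos_sq_add_sin_sq (z.arg / 3)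
    refine ⟨Real.cos (z.arg / 3), Real.sin (z.arg / 3), hone, ?_, ?_⟩
    · rw [← hcos, h3, Real.cos_three_mul, ← h3]
      linear_combination 3 * Real.cos (z.arg / 3) * hone
    · rw [← hsin, h3, Real.sin_three_mul, ← h3]
      linear_combination -3 * Real.sin (z.arg / 3) * hone
  have hk : (√3) ^ 2 = (3 : ℝ) := Real.sq_sqrt (by norm_num)
  have hid := cubic_interpolation A B C D c s (√3) hk
  rw [hcs, one_pow, mul_one] at hid
  rw [← hid]
  have h0 := abs_le.1 (h c s hcs)
  have h1 := abs_le.1 (h (-c / 2 - √3 / 2 * s) (-s / 2 + √3 / 2 * c)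
    (by linear_combination hcs + (s ^ 2 + c ^ 2) / 4 * hk))
  have h2 := abs_le.1 (h (-c / 2 + √3 / 2 * s) (-s / 2 - √3 / 2 * c)
    (by linear_combination hcs + (s ^ 2 + c ^ 2) / 4 * hk))
  have hw : ((3 * c ^ 2 - s ^ 2) / 3) ^ 2 + ((2 * s ^ 2 + 2 * √3 * c * s) / 3) ^ 2
      + ((2 * s ^ 2 - 2 * √3 * c * s) / 3) ^ 2 = 1 := by
    linear_combination (c ^ 2 + s ^ 2 + 1) * hcs + 8 / 9 * c ^ 2 * s ^ 2 * hk
  have w0 := sq_nonneg ((3 * c ^ 2 - s ^ 2) / 3)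
  have w1 := sq_nonneg ((2 * s ^ 2 + 2 * √3 * c * s) / 3)
  have w2 := sq_nonneg ((2 * s ^ 2 - 2 * √3 * c * s) / 3)
  rw [abs_le]
  constructor
  · have e0 := mul_le_mul_of_nonneg_left h0.1 w0
    have e1 := mul_le_mul_of_nonneg_left h1.1 w1
    have e2 := mul_le_mul_of_nonneg_left h2.1 w2
    have e3 := congrArg (fun r => r * -M) hw
    simp only [add_mul, one_mul] at e3
    linarith
  · have e0 := mul_le_mul_of_nonneg_left h0.2 w0
    have e1 := mul_le_mul_of_nonneg_left h1.2 w1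
    have e2 := mul_le_mul_of_nonneg_left h2.2 w2
    have e3 := congrArg (fun r => r * M) hw
    simp only [add_mul, one_mul] at e3
    linarith

theorem trilinear_polarization_unit [NormedSpace ℝ E] (T : E →L[ℝ] E →L[ℝ] E →L[ℝ] ℝ)
    (B : E →L[ℝ] E →L[ℝ] ℝ) (hT12 : ∀ u v w, T u v w = T v u w) (hT23 : ∀ u v w, T u v w = T u w v)
    (hB : ∀ v w, B v w = B w v) (hBpos : ∀ v, v ≠ 0 → 0 < B v v) {M : ℝ}
    (h : ∀ v, B v v = 1 → |T v v v| ≤ M) {u v : E} (hu : B u u = 1) (hv : B v v = 1) :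
    |T u v v| ≤ M := by
  set a := B u v with ha
  by_cases hw : u - a • v = 0
  · have huv : u = a • v := sub_eq_zero.1 hw
    have ha2 : |a| = 1 := by
      rw [huv] at hu
      simp only [map_smul, smul_apply, smul_eq_mul, hv, mul_one] at hu
      rw [← Real.sqrt_mul_self_eq_abs, hu, Real.sqrt_one]
    rw [huv]
    simp only [map_smul, smul_apply, smul_eq_mul]
    rw [abs_mul, ha2, one_mul]
    exact h v hv
  · set w := u - a • v with hwdef
    set b := √(B w w) with hb
    have hb0 : 0 < b := Real.sqrt_pos.2 (hBpos w hw)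
    have hb2 : b ^ 2 = B w w := Real.sq_sqrt (hBpos w hw).le
    have hBw : B w w = 1 - a ^ 2 := by
      simp only [hwdef, map_sub, map_smul, sub_apply,
        smul_apply, smul_eq_mul, hu, hv, hB v u, ← ha]
      ring
    have hvw : B v w = 0 := by
      simp only [hwdef, map_sub, map_smul, smul_eq_mul, hv, hB v u, ← ha]
      ring
    have hu' : u = a • v + b • (b⁻¹ • w) := by
      rw [smul_smul, mul_inv_cancel₀ hb0.ne', one_smul, hwdef]
      abel
    set e := b⁻¹ • w with he
    have hve : B v e = 0 := by simp [he, hvw]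
    have hee : B e e = 1 := by
      simp only [he, map_smul, smul_apply, smul_eq_mul, ← hb2]
      field_simp
    -- Now `v, e` are `B`-orthonormal and `u = a v + b e`, so only the restriction of `T` to the
    -- plane they span matters.
    have := binary_cubic_polarization_le (A := T v v v) (B := T e v v) (C := T e e v)
      (D := T e e e) (M := M) (a := a) (b := b) (fun c s hcs => ?_) (by rw [hb2, hBw]; ring)
    · rw [hu']
      simp only [map_add, map_smul, add_apply,
        smul_apply, smul_eq_mul]
      rwa [mul_comm a, mul_comm b]
    · have h1 := h (c • v + s • e) (by
        simp only [map_add, map_smul, add_apply,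
          smul_apply, smul_eq_mul, hv, hee, hB e v, hve]
        linear_combination hcs)
      convert h1 using 2
      simp only [map_add, map_smul, add_apply,
        smul_apply, smul_eq_mul]
      rw [hT12 v e v, hT23 v v e, hT12 v e v, hT12 v e e, hT23 e v e]
      ring

theorem trilinear_polarization_of_posDef [NormedSpace ℝ E] (T : E →L[ℝ] E →L[ℝ] E →L[ℝ] ℝ)
    (B : E →L[ℝ] E →L[ℝ] ℝ) (hT12 : ∀ u v w, T u v w = T v u w) (hT23 : ∀ u v w, T u v w = T u w v)
    (hB : ∀ v w, B v w = B w v) (hBpos : ∀ v, v ≠ 0 → 0 < B v v) {M : ℝ}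
    (h : ∀ v, |T v v v| ≤ M * √(B v v) ^ 3) (u v : E) :
    |T u v v| ≤ M * √(B u u) * B v v := by
  rcases eq_or_ne u 0 with rfl | hu
  · simp
  rcases eq_or_ne v 0 with rfl | hv
  · simp
  set p := √(B u u) with hp
  set q := √(B v v) with hq
  have hp0 : 0 < p := Real.sqrt_pos.2 (hBpos u hu)
  have hq0 : 0 < q := Real.sqrt_pos.2 (hBpos v hv)
  have hp2 : p ^ 2 = B u u := Real.sq_sqrt (hBpos u hu).le
  have hq2 : q ^ 2 = B v v := Real.sq_sqrt (hBpos v hv).le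
  have key := trilinear_polarization_unit T B hT12 hT23 hB hBpos (M := M)
    (fun v hv => by simpa [hv] using h v) (u := p⁻¹ • u) (v := q⁻¹ • v)
    (by simp only [map_smul, smul_apply, smul_eq_mul, ← hp2]; field_simp)
    (by simp only [map_smul, smul_apply, smul_eq_mul, ← hq2]; field_simp)
  simp only [map_smul, smul_apply, smul_eq_mul] at key
  have e : T u v v = p * q ^ 2 * (q⁻¹ * (q⁻¹ * (p⁻¹ * T u v v))) := by field_simp
  rw [e, abs_mul, abs_of_pos (by positivity : 0 < p * q ^ 2), ← hq2]
  calc p * q ^ 2 * |q⁻¹ * (q⁻¹ * (p⁻¹ * T u v v))| ≤ p * q ^ 2 * M := by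
        gcongr
    _ = M * p * q ^ 2 := by ring

/-- Banach's polarization inequality for symmetric trilinear forms: if `|T v v v| ≤ M ‖v‖³` for the
seminorm of a positive semidefinite form `B`, then `|T u v v| ≤ M ‖u‖ ‖v‖²`. -/
theorem trilinear_polarization [InnerProductSpace ℝ E] (T : E →L[ℝ] E →L[ℝ] E →L[ℝ] ℝ)
    (B : E →L[ℝ] E →L[ℝ] ℝ) (hT12 : ∀ u v w, T u v w = T v u w) (hT23 : ∀ u v w, T u v w = T u w v)
    (hB : ∀ v w, B v w = B w v) (hB0 : ∀ v, 0 ≤ B v v) {M : ℝ} (hM : 0 ≤ M)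
    (h : ∀ v, |T v v v| ≤ M * √(B v v) ^ 3) (u v : E) :
    |T u v v| ≤ M * √(B u u) * B v v := by
  -- `B` may be degenerate, so `ε` times the inner product is added and then `ε → 0`.
  have hε : ∀ ε : ℝ, 0 < ε →
      |T u v v| ≤ M * √(B u u + ε * ‖u‖ ^ 2) * (B v v + ε * ‖v‖ ^ 2) := by
    intro ε hε
    set I : E →L[ℝ] E →L[ℝ] ℝ :=
      (isBoundedBilinearMap_inner (𝕜 := ℝ) (E := E)).toContinuousLinearMap
    have hBε : ∀ v w, (B + ε • I) v w = B v w + ε * ⟪v, w⟫ := fun v w => rfl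
    have := trilinear_polarization_of_posDef T (B + ε • I) hT12 hT23 (M := M)
      (fun v w => by rw [hBε, hBε, hB v w, real_inner_comm])
      (fun v hv => by
        rw [hBε, real_inner_self_eq_norm_sq]
        have := hB0 v
        have := norm_pos_iff.2 hv
        positivity)
      (fun v => (h v).trans (by
        rw [hBε, real_inner_self_eq_norm_sq]
        gcongr
        have : 0 ≤ ε * ‖v‖ ^ 2 := by positivity
        linarith)) u v
    simpa only [hBε, real_inner_self_eq_norm_sq] using this
  have hlim : Filter.Tendsto
      (fun ε : ℝ => M * √(B u u + ε * ‖u‖ ^ 2) * (B v v + ε * ‖v‖ ^ 2)) (𝓝[>] 0)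
      (𝓝 (M * √(B u u) * B v v)) := by
    have hc : Continuous (fun ε : ℝ => M * √(B u u + ε * ‖u‖ ^ 2) * (B v v + ε * ‖v‖ ^ 2)) := by
      fun_prop
    have := hc.tendsto 0
    simp only [zero_mul, add_zero] at this
    exact this.mono_left nhdsWithin_le_nhds
  exact ge_of_tendsto hlim (by filter_upwards [self_mem_nhdsWithin] with ε h using hε ε h)

end Forms

/-! ### Comparison of functions of one real variable -/

section OneVariable

theorem sub_le_sub_of_hasDerivAt_le {h k h' k' : ℝ → ℝ} {b : ℝ} (hb : 0 ≤ b)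
    (hh : ∀ t ∈ Set.Icc 0 b, HasDerivAt h (h' t) t) (hk : ∀ t ∈ Set.Icc 0 b, HasDerivAt k (k' t) t)
    (hle : ∀ t ∈ Set.Icc 0 b, h' t ≤ k' t) : h b - h 0 ≤ k b - k 0 := by
  rcases hb.eq_or_lt with rfl | hb
  · simp
  obtain ⟨c, hc, e⟩ := exists_hasDerivAt_eq_slope (fun t => k t - h t) (fun t => k' t - h' t) hb
    (fun t ht => ((hk t ht).sub (hh t ht)).continuousAt.continuousWithinAt)
    (fun t ht => (hk t (Set.Ioo_subset_Icc_self ht)).sub (hh t (Set.Ioo_subset_Icc_self ht)))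
  have h1 := hle c (Set.Ioo_subset_Icc_self hc)
  rw [eq_div_iff (by linarith)] at e
  nlinarith

theorem abs_sub_le_sub_of_hasDerivAt_le {h k h' k' : ℝ → ℝ} {b : ℝ} (hb : 0 ≤ b)
    (hh : ∀ t ∈ Set.Icc 0 b, HasDerivAt h (h' t) t) (hk : ∀ t ∈ Set.Icc 0 b, HasDerivAt k (k' t) t)
    (hle : ∀ t ∈ Set.Icc 0 b, |h' t| ≤ k' t) : |h b - h 0| ≤ k b - k 0 := by
  have h1 := sub_le_sub_of_hasDerivAt_le hb hh hk (fun t ht => (abs_le.1 (hle t ht)).2)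
  have h2 := sub_le_sub_of_hasDerivAt_le hb (fun t ht => (hh t ht).neg) hk
    (fun t ht => by linarith [(abs_le.1 (hle t ht)).1])
  simp only [Pi.neg_apply] at h2
  exact abs_le.2 ⟨by linarith, h1⟩

/-- The hypothesis says that `q^(-1/2)` is 1-Lipschitz; the shift by `ε` keeps this meaningful where
`q` vanishes. -/
theorem abs_inv_sqrt_sub_le {q q' : ℝ → ℝ} {b ε : ℝ} (hb : 0 ≤ b) (hε : 0 < ε)
    (hq : ∀ t ∈ Set.Icc 0 b, HasDerivAt q (q' t) t) (hq0 : ∀ t ∈ Set.Icc 0 b, 0 ≤ q t)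
    (hle : ∀ t ∈ Set.Icc 0 b, |q' t| ≤ 2 * √(q t) ^ 3) :
    |(√(q b + ε))⁻¹ - (√(q 0 + ε))⁻¹| ≤ b := by
  have := abs_sub_le_sub_of_hasDerivAt_le (h := fun t => (√(q t + ε))⁻¹) (k := fun t => t)
    (k' := fun _ => 1) hb
    (fun t ht => (((hq t ht).add_const ε).sqrt (by linarith [hq0 t ht])).inv
      (Real.sqrt_pos.2 (by linarith [hq0 t ht])).ne')
    (fun t _ => hasDerivAt_id t)
    (fun t ht => ?_)
  · simpa using this
  · have hp : 0 < √(q t + ε) := Real.sqrt_pos.2 (by linarith [hq0 t ht])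
    have hs : √(q t) ≤ √(q t + ε) := Real.sqrt_le_sqrt (by linarith)
    rw [abs_div, abs_neg, abs_div, abs_of_pos (by positivity : 0 < 2 * √(q t + ε)),
      abs_of_pos (by positivity : 0 < √(q t + ε) ^ 2), div_div, div_le_one (by positivity)]
    calc |q' t| ≤ 2 * √(q t) ^ 3 := hle t ht
      _ ≤ 2 * √(q t + ε) ^ 3 := by gcongr
      _ = _ := by ring

/-- The Lipschitz bound on `q^(-1/2)`, multiplied out so that it survives `ε → 0` even if `q` has
zeros. -/
theorem sqrt_growth_of_self_concordant {q q' : ℝ → ℝ} {b : ℝ} (hb : 0 ≤ b)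
    (hq : ∀ t ∈ Set.Icc 0 b, HasDerivAt q (q' t) t) (hq0 : ∀ t ∈ Set.Icc 0 b, 0 ≤ q t)
    (hle : ∀ t ∈ Set.Icc 0 b, |q' t| ≤ 2 * √(q t) ^ 3) :
    √(q b) * (1 - b * √(q 0)) ≤ √(q 0) ∧ √(q 0) ≤ √(q b) * (1 + b * √(q 0)) := by
  have key : ∀ ε : ℝ, 0 < ε → √(q b + ε) * (1 - b * √(q 0 + ε)) ≤ √(q 0 + ε) ∧
      √(q 0 + ε) ≤ √(q b + ε) * (1 + b * √(q 0 + ε)) := by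
    intro ε hε
    have h := abs_le.1 (abs_inv_sqrt_sub_le hb hε hq hq0 hle)
    have hP : 0 < √(q 0 + ε) := Real.sqrt_pos.2 (by linarith [hq0 0 ⟨le_rfl, hb⟩])
    have hQ : 0 < √(q b + ε) := Real.sqrt_pos.2 (by linarith [hq0 b ⟨hb, le_rfl⟩])
    have hPQ := (mul_pos hP hQ).le
    have e1 := mul_le_mul_of_nonneg_left h.1 hPQ
    have e2 := mul_le_mul_of_nonneg_left h.2 hPQ
    have e3 : √(q 0 + ε) * √(q b + ε) * ((√(q b + ε))⁻¹ - (√(q 0 + ε))⁻¹) =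
      √(q 0 + ε) - √(q b + ε) := by field_simp
    rw [e3] at e1 e2
    constructor <;> nlinarith
  have c1 : Continuous (fun ε : ℝ => √(q b + ε) * (1 - b * √(q 0 + ε))) := by fun_prop
  have c2 : Continuous (fun ε : ℝ => √(q 0 + ε)) := by fun_prop
  have c3 : Continuous (fun ε : ℝ => √(q b + ε) * (1 + b * √(q 0 + ε))) := by fun_prop
  have t1 := (c1.tendsto 0).mono_left (nhdsWithin_le_nhds (s := Set.Ioi 0))
  have t2 := (c2.tendsto 0).mono_left (nhdsWithin_le_nhds (s := Set.Ioi 0))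
  have t3 := (c3.tendsto 0).mono_left (nhdsWithin_le_nhds (s := Set.Ioi 0))
  simp only [add_zero] at t1 t2 t3
  constructor
  · exact le_of_tendsto_of_tendsto t1 t2
      (by filter_upwards [self_mem_nhdsWithin] with ε h using (key ε h).1)
  · exact le_of_tendsto_of_tendsto t2 t3
      (by filter_upwards [self_mem_nhdsWithin] with ε h using (key ε h).2)

end OneVariable

/-! ### Proper closed convex functions -/

namespace IsProperClosedConvex

variable {n : ℕ} {h : Rn n → EReal}

theorem coe_toRealFun (hh : IsProperClosedConvex h) {x : Rn n} (hx : x ∈ effDom h) :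
    (toRealFun h x : EReal) = h x :=
  EReal.coe_toReal (ne_of_lt hx) (hh.ne_bot x)

theorem convexOn (hh : IsProperClosedConvex h) : ConvexOn ℝ (effDom h) (toRealFun h) := by
  have key : ∀ x ∈ effDom h, ∀ y ∈ effDom h, ∀ a b : ℝ, 0 ≤ a → 0 ≤ b → a + b = 1 →
      h (a • x + b • y) ≤ ((a * toRealFun h x + b * toRealFun h y : ℝ) : EReal) := by
    intro x hx y hy a b ha hb hab
    have hp : (x, toRealFun h x) ∈ {p : Rn n × ℝ | h p.1 ≤ (p.2 : EReal)} :=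
      (hh.coe_toRealFun hx).ge
    have hq : (y, toRealFun h y) ∈ {p : Rn n × ℝ | h p.1 ≤ (p.2 : EReal)} :=
      (hh.coe_toRealFun hy).ge
    exact hh.convex hp hq ha hb hab
  have hdom : Convex ℝ (effDom h) := fun x hx y hy a b ha hb hab =>
    (key x hx y hy a b ha hb hab).trans_lt (EReal.coe_lt_top _)
  refine ⟨hdom, fun x hx y hy a b ha hb hab => ?_⟩
  have := key x hx y hy a b ha hb hab
  rw [← hh.coe_toRealFun (hdom hx hy ha hb hab), EReal.coe_le_coe_iff] at this
  exact this

theorem add_smul_mem (hh : IsProperClosedConvex h) {x u : Rn n} (hx : x ∈ effDom h) {b : ℝ}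
    (hu : x + b • u ∈ effDom h) {t : ℝ} (ht : t ∈ Set.Icc 0 b) : x + t • u ∈ effDom h := by
  rcases ht.1.eq_or_lt with rfl | h0
  · simpa using hx
  have hb : 0 < b := h0.trans_le ht.2
  have := hh.convexOn.1.add_smul_sub_mem hx hu
    (t := t / b) ⟨by positivity, (div_le_one hb).2 ht.2⟩
  rwa [add_sub_cancel_left, smul_smul, div_mul_cancel₀ _ hb.ne'] at this

end IsProperClosedConvex

/-! ### Derivatives of a self-concordant function -/

/-- The second derivative of `f` as a bilinear form. -/
noncomputable abbrev hessForm {n : ℕ} (f : Rn n → EReal) (x : Rn n) :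
    Rn n →L[ℝ] Rn n →L[ℝ] ℝ :=
  fderiv ℝ (fderiv ℝ (toRealFun f)) x

/-- The third derivative of `f` as a trilinear form. -/
noncomputable abbrev thirdForm {n : ℕ} (f : Rn n → EReal) (x : Rn n) :
    Rn n →L[ℝ] Rn n →L[ℝ] Rn n →L[ℝ] ℝ :=
  fderiv ℝ (hessForm f) x

theorem inner_grad {n : ℕ} (f : Rn n → EReal) (x v : Rn n) :
    ⟪grad f x, v⟫ = fderiv ℝ (toRealFun f) x v := by
  simp [grad, gradient]

namespace IsStandardSelfConcordant

variable {n : ℕ} {f : Rn n → EReal}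

theorem contDiffAt (hf : IsStandardSelfConcordant f) {x : Rn n} (hx : x ∈ effDom f) :
    ContDiffAt ℝ 3 (toRealFun f) x :=
  hf.contDiffOn.contDiffAt (hf.isOpen_dom.mem_nhds hx)

theorem contDiffAt_fderiv (hf : IsStandardSelfConcordant f) {x : Rn n} (hx : x ∈ effDom f) :
    ContDiffAt ℝ 2 (fderiv ℝ (toRealFun f)) x :=
  (hf.contDiffAt hx).fderiv_right (by norm_num)

theorem contDiffAt_hessForm (hf : IsStandardSelfConcordant f) {x : Rn n} (hx : x ∈ effDom f) :
    ContDiffAt ℝ 1 (hessForm f) x :=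
  (hf.contDiffAt_fderiv hx).fderiv_right (by norm_num)

theorem hessForm_symm (hf : IsStandardSelfConcordant f) {x : Rn n} (hx : x ∈ effDom f)
    (v w : Rn n) : hessForm f x v w = hessForm f x w v :=
  (hf.contDiffAt hx).isSymmSndFDerivAt
    (by rw [minSmoothness_of_isRCLikeNormedField]; norm_num) v w

theorem thirdForm_symm_left (hf : IsStandardSelfConcordant f) {x : Rn n} (hx : x ∈ effDom f)
    (u v w : Rn n) : thirdForm f x u v w = thirdForm f x v u w :=
  DFunLike.congr_fun ((hf.contDiffAt_fderiv hx).isSymmSndFDerivAt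
    (by rw [minSmoothness_of_isRCLikeNormedField]) u v) w

theorem _root_.hasDerivAt_add_smul (x u : Rn n) (t : ℝ) :
    HasDerivAt (fun τ : ℝ => x + τ • u) u t := by
  simpa using ((hasDerivAt_id t).smul_const u).const_add x

theorem eventually_line_mem (hf : IsStandardSelfConcordant f) {x u : Rn n} {t : ℝ}
    (hx : x + t • u ∈ effDom f) : ∀ᶠ τ in 𝓝 t, x + τ • u ∈ effDom f :=
  (hasDerivAt_add_smul x u t).continuousAt.eventually_mem (hf.isOpen_dom.mem_nhds hx)

theorem hasDerivAt_line (hf : IsStandardSelfConcordant f) {x u : Rn n} {t : ℝ}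
    (hx : x + t • u ∈ effDom f) :
    HasDerivAt (fun τ : ℝ => toRealFun f (x + τ • u))
      (fderiv ℝ (toRealFun f) (x + t • u) u) t := by
  have h : HasFDerivAt (toRealFun f) _ ((fun τ : ℝ => x + τ • u) t) :=
    ((hf.contDiffAt hx).differentiableAt (by norm_num)).hasFDerivAt
  exact h.comp_hasDerivAt t (hasDerivAt_add_smul x u t)

theorem hasDerivAt_fderiv_line (hf : IsStandardSelfConcordant f) {x u : Rn n} {t : ℝ}
    (hx : x + t • u ∈ effDom f) (v : Rn n) :
    HasDerivAt (fun τ : ℝ => fderiv ℝ (toRealFun f) (x + τ • u) v)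
      (hessForm f (x + t • u) u v) t := by
  have h : HasFDerivAt (fderiv ℝ (toRealFun f)) _ ((fun τ : ℝ => x + τ • u) t) :=
    ((hf.contDiffAt_fderiv hx).differentiableAt (by norm_num)).hasFDerivAt
  exact ((ContinuousLinearMap.apply ℝ ℝ v).hasFDerivAt).comp_hasDerivAt t
    (h.comp_hasDerivAt t (hasDerivAt_add_smul x u t))

theorem hasDerivAt_hessForm_line (hf : IsStandardSelfConcordant f) {x u : Rn n} {t : ℝ}
    (hx : x + t • u ∈ effDom f) (v w : Rn n) :
    HasDerivAt (fun τ : ℝ => hessForm f (x + τ • u) v w)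
      (thirdForm f (x + t • u) u v w) t := by
  have h : HasFDerivAt (hessForm f) _ ((fun τ : ℝ => x + τ • u) t) :=
    ((hf.contDiffAt_hessForm hx).differentiableAt (by norm_num)).hasFDerivAt
  have h1 : HasDerivAt (fun τ : ℝ => hessForm f (x + τ • u)) (thirdForm f (x + t • u) u) t :=
    HasFDerivAt.comp_hasDerivAt (l := hessForm f) t h (hasDerivAt_add_smul x u t)
  simpa using (h1.clm_apply (hasDerivAt_const t v)).clm_apply (hasDerivAt_const t w)

theorem thirdForm_symm_right (hf : IsStandardSelfConcordant f) {x : Rn n} (hx : x ∈ effDom f)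
    (u v w : Rn n) : thirdForm f x u v w = thirdForm f x u w v := by
  have hx' : x + (0 : ℝ) • u ∈ effDom f := by simpa using hx
  have h1 := hf.hasDerivAt_hessForm_line hx' v w
  have h2 := hf.hasDerivAt_hessForm_line hx' w v
  have he : (fun τ : ℝ => hessForm f (x + τ • u) v w) =ᶠ[𝓝 0]
      (fun τ : ℝ => hessForm f (x + τ • u) w v) := by
    filter_upwards [hf.eventually_line_mem hx'] with τ hτ using hf.hessForm_symm hτ v w
  simpa using h1.unique (h2.congr_of_eventuallyEq he)

theorem deriv_line (hf : IsStandardSelfConcordant f) {x u : Rn n} {t : ℝ}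
    (hx : x + t • u ∈ effDom f) :
    deriv (fun τ : ℝ => toRealFun f (x + τ • u)) =ᶠ[𝓝 t]
      fun τ => fderiv ℝ (toRealFun f) (x + τ • u) u := by
  filter_upwards [hf.eventually_line_mem hx] with τ hτ using (hf.hasDerivAt_line hτ).deriv

theorem iteratedDeriv_two_line (hf : IsStandardSelfConcordant f) {x u : Rn n} {t : ℝ}
    (hx : x + t • u ∈ effDom f) :
    iteratedDeriv 2 (fun τ : ℝ => toRealFun f (x + τ • u)) t = hessForm f (x + t • u) u u := by
  rw [iteratedDeriv_succ, iteratedDeriv_one, (hf.deriv_line hx).deriv_eq]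
  exact (hf.hasDerivAt_fderiv_line hx u).deriv

theorem iteratedDeriv_three_line (hf : IsStandardSelfConcordant f) {x u : Rn n} {t : ℝ}
    (hx : x + t • u ∈ effDom f) :
    iteratedDeriv 3 (fun τ : ℝ => toRealFun f (x + τ • u)) t =
      thirdForm f (x + t • u) u u u := by
  have he : iteratedDeriv 2 (fun τ : ℝ => toRealFun f (x + τ • u)) =ᶠ[𝓝 t]
      fun τ => hessForm f (x + τ • u) u u := by
    filter_upwards [hf.eventually_line_mem hx] with τ hτ using hf.iteratedDeriv_two_line hτ
  rw [iteratedDeriv_succ, he.deriv_eq]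
  exact (hf.hasDerivAt_hessForm_line hx u u).deriv

theorem hessForm_nonneg (hf : IsStandardSelfConcordant f) {x : Rn n} (hx : x ∈ effDom f)
    (u : Rn n) : 0 ≤ hessForm f x u u := by
  have hx' : x + (0 : ℝ) • u ∈ effDom f := by simpa using hx
  set S : Set ℝ := {τ | x + τ • u ∈ effDom f} with hS
  have hconv : ConvexOn ℝ S (fun τ : ℝ => toRealFun f (x + τ • u)) := by
    have he : ∀ a b σ τ : ℝ, a + b = 1 →
        x + (a • σ + b • τ) • u = a • (x + σ • u) + b • (x + τ • u) := by
      intro a b σ τ hab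
      rw [smul_add, smul_add, smul_smul, smul_smul, add_add_add_comm, ← add_smul, hab, one_smul,
        add_smul, smul_eq_mul, smul_eq_mul]
    refine ⟨fun σ hσ τ hτ a b ha hb hab => ?_, fun σ hσ τ hτ a b ha hb hab => ?_⟩
    · rw [hS, Set.mem_ofPred_eq, he a b σ τ hab]
      exact hf.closedConvex.convexOn.1 hσ hτ ha hb hab
    · simp only [he a b σ τ hab]
      exact hf.closedConvex.convexOn.2 hσ hτ ha hb hab
  have hmono := hconv.monotoneOn_deriv (fun τ hτ => (hf.hasDerivAt_line hτ).differentiableAt)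
  have h := hmono.derivWithin_nonneg (x := 0)
  rw [derivWithin_of_mem_nhds (hf.eventually_line_mem hx'), (hf.deriv_line hx').deriv_eq,
    (hf.hasDerivAt_fderiv_line hx' u).deriv] at h
  simpa using h

theorem abs_thirdForm_diag_le (hf : IsStandardSelfConcordant f) {x : Rn n} (hx : x ∈ effDom f)
    (u : Rn n) : |thirdForm f x u u u| ≤ 2 * √(hessForm f x u u) ^ 3 := by
  have hx' : x + (0 : ℝ) • u ∈ effDom f := by simpa using hx
  have h := hf.third_deriv_le x hx u 0 hx'
  rw [hf.iteratedDeriv_three_line hx', hf.iteratedDeriv_two_line hx', zero_smul, add_zero] at h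
  refine h.trans_eq ?_
  rw [Real.sqrt_eq_rpow, ← Real.rpow_natCast, ← Real.rpow_mul (hf.hessForm_nonneg hx u)]
  norm_num

theorem abs_thirdForm_le (hf : IsStandardSelfConcordant f) {x : Rn n} (hx : x ∈ effDom f)
    (u v : Rn n) :
    |thirdForm f x u v v| ≤ 2 * √(hessForm f x u u) * hessForm f x v v :=
  trilinear_polarization (thirdForm f x) (hessForm f x) (hf.thirdForm_symm_left hx)
    (hf.thirdForm_symm_right hx) (hf.hessForm_symm hx) (hf.hessForm_nonneg hx) (by norm_num)
    (hf.abs_thirdForm_diag_le hx) u v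

theorem inner_hess (hf : IsStandardSelfConcordant f) {x : Rn n} (hx : x ∈ effDom f)
    (v w : Rn n) : ⟪v, hess f x w⟫ = hessForm f x w v := by
  have hd2 : DifferentiableAt ℝ (fderiv ℝ (toRealFun f)) x :=
    (hf.contDiffAt_fderiv hx).differentiableAt (by norm_num)
  have hd : DifferentiableAt ℝ (grad f) x := by
    -- The coordinates of the gradient are partial derivatives, differentiable because `fderiv` is.
    rw [differentiableAt_euclidean]
    intro i
    have : (fun y => grad f y i) =
        fun y => fderiv ℝ (toRealFun f) y (EuclideanSpace.single i (1 : ℝ)) := by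
      ext y
      rw [← inner_grad, EuclideanSpace.inner_single_right]
      simp
    rw [this]
    exact hd2.clm_apply (differentiableAt_const _)
  have h1 : HasFDerivAt (fun y => ⟪v, grad f y⟫) ((innerSL ℝ v).comp (hess f x)) x :=
    (innerSL ℝ v).hasFDerivAt.comp x hd.hasFDerivAt
  have h2 : HasFDerivAt (fun y => fderiv ℝ (toRealFun f) y v)
      ((ContinuousLinearMap.apply ℝ ℝ v).comp (hessForm f x)) x :=
    (ContinuousLinearMap.apply ℝ ℝ v).hasFDerivAt.comp x hd2.hasFDerivAt
  have he : (fun y => ⟪v, grad f y⟫) = fun y => fderiv ℝ (toRealFun f) y v := by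
    ext y
    rw [real_inner_comm, inner_grad]
  rw [he] at h1
  exact DFunLike.congr_fun (h1.unique h2) w

theorem localNorm_eq (hf : IsStandardSelfConcordant f) {x : Rn n} (hx : x ∈ effDom f)
    (v : Rn n) : localNorm f x v = √(hessForm f x v v) := by
  rw [localNorm, hf.inner_hess hx]

theorem localNorm_sq (hf : IsStandardSelfConcordant f) {x : Rn n} (hx : x ∈ effDom f)
    (v : Rn n) : localNorm f x v ^ 2 = hessForm f x v v := by
  rw [hf.localNorm_eq hx, Real.sq_sqrt (hf.hessForm_nonneg hx v)]

theorem localNorm_add_le (hf : IsStandardSelfConcordant f) {x : Rn n} (hx : x ∈ effDom f)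
    (v w : Rn n) : localNorm f x (v + w) ≤ localNorm f x v + localNorm f x w := by
  simp only [hf.localNorm_eq hx]
  exact sqrt_diag_add_le _ (hf.hessForm_symm hx) (hf.hessForm_nonneg hx) v w

theorem localNorm_smul (hf : IsStandardSelfConcordant f) {x : Rn n} (hx : x ∈ effDom f)
    (c : ℝ) (v : Rn n) : localNorm f x (c • v) = |c| * localNorm f x v := by
  simp only [hf.localNorm_eq hx]
  exact sqrt_diag_smul _ c v

end IsStandardSelfConcordant

theorem localNorm_nonneg {n : ℕ} (f : Rn n → EReal) (x v : Rn n) : 0 ≤ localNorm f x v :=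
  Real.sqrt_nonneg _

/-! ### Estimates for self-concordant functions -/

namespace IsStandardSelfConcordant

variable {n : ℕ} {f : Rn n → EReal}

theorem localNorm_line (hf : IsStandardSelfConcordant f) {x u : Rn n} (hx : x ∈ effDom f) {t : ℝ}
    (ht : 0 ≤ t) (hxt : x + t • u ∈ effDom f) :
    localNorm f (x + t • u) u * (1 - t * localNorm f x u) ≤ localNorm f x u ∧
      localNorm f x u ≤ localNorm f (x + t • u) u * (1 + t * localNorm f x u) := by
  have hmem : ∀ τ ∈ Set.Icc 0 t, x + τ • u ∈ effDom f :=
    fun τ hτ => hf.closedConvex.add_smul_mem hx hxt hτ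
  have := sqrt_growth_of_self_concordant (q := fun τ => hessForm f (x + τ • u) u u) ht
    (fun τ hτ => hf.hasDerivAt_hessForm_line (hmem τ hτ) u u)
    (fun τ hτ => hf.hessForm_nonneg (hmem τ hτ) u)
    (fun τ hτ => hf.abs_thirdForm_diag_le (hmem τ hτ) u)
  simp only [zero_smul, add_zero] at this
  rwa [hf.localNorm_eq hx, hf.localNorm_eq hxt]

/-- Along the line, with `r = ‖u‖_x`, the Hessian form on `v` has logarithmic derivative at most
`2r/(1 - τr)` in absolute value. Hence its product with `(1 - τr)²` decreases and its quotient by it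
increases. -/
theorem hessForm_line (hf : IsStandardSelfConcordant f) {x u : Rn n} (hx : x ∈ effDom f) {t : ℝ}
    (ht : 0 ≤ t) (hxt : x + t • u ∈ effDom f) (hr : t * localNorm f x u < 1) (v : Rn n) :
    hessForm f (x + t • u) v v * (1 - t * localNorm f x u) ^ 2 ≤ hessForm f x v v ∧
      hessForm f x v v * (1 - t * localNorm f x u) ^ 2 ≤ hessForm f (x + t • u) v v := by
  have hmem : ∀ τ ∈ Set.Icc 0 t, x + τ • u ∈ effDom f :=
    fun τ hτ => hf.closedConvex.add_smul_mem hx hxt hτ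
  set r := localNorm f x u with hrdef
  have hr0 : 0 ≤ r := localNorm_nonneg f x u
  have hpos : ∀ τ ∈ Set.Icc 0 t, 0 < 1 - τ * r := by
    intro τ hτ
    have := mul_le_mul_of_nonneg_right hτ.2 hr0
    linarith
  have hthird : ∀ τ ∈ Set.Icc 0 t,
      |thirdForm f (x + τ • u) u v v| * (1 - τ * r) ≤ 2 * r * hessForm f (x + τ • u) v v := by
    intro τ hτ
    have h1 := hf.abs_thirdForm_le (hmem τ hτ) u v
    have h2 := (hf.localNorm_line hx hτ.1 (hmem τ hτ)).1
    rw [← hrdef, hf.localNorm_eq (hmem τ hτ)] at h2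
    have h3 := hf.hessForm_nonneg (hmem τ hτ) v
    have h4 := mul_le_mul_of_nonneg_right h1 (hpos τ hτ).le
    have h5 := mul_le_mul_of_nonneg_right h2 h3
    linarith
  have hlin : ∀ τ : ℝ, HasDerivAt (fun τ : ℝ => (1 - τ * r) ^ 2) (-2 * r * (1 - τ * r)) τ := by
    intro τ
    have h := (((hasDerivAt_id τ).mul_const r).const_sub 1).pow 2
    refine h.congr_deriv ?_
    simp
    ring
  constructor
  · have := sub_le_sub_of_hasDerivAt_le
      (h := fun τ => hessForm f (x + τ • u) v v * (1 - τ * r) ^ 2)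
      (k := fun _ => 0) (k' := fun _ => 0) ht
      (fun τ hτ => (hf.hasDerivAt_hessForm_line (hmem τ hτ) v v).mul (hlin τ))
      (fun τ _ => hasDerivAt_const τ 0) (fun τ hτ => ?_)
    · simp only [zero_smul, add_zero, zero_mul, sub_zero, one_pow, mul_one] at this
      linarith
    · have h1 := hthird τ hτ
      have h2 := mul_le_mul_of_nonneg_right (le_abs_self (thirdForm f (x + τ • u) u v v))
        (hpos τ hτ).le
      have h3 := mul_le_mul_of_nonneg_right (h2.trans h1) (hpos τ hτ).le
      linarith
  · have := sub_le_sub_of_hasDerivAt_le (h := fun _ => 0) (h' := fun _ => 0)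
      (k := fun τ => hessForm f (x + τ • u) v v / (1 - τ * r) ^ 2) ht
      (fun τ _ => hasDerivAt_const τ 0)
      (fun τ hτ => (hf.hasDerivAt_hessForm_line (hmem τ hτ) v v).div (hlin τ)
        (pow_ne_zero 2 (hpos τ hτ).ne'))
      (fun τ hτ => ?_)
    · simp only [zero_smul, add_zero, zero_mul, sub_zero, one_pow, div_one] at this
      have hp := hpos t ⟨ht, le_rfl⟩
      rw [← le_div_iff₀ (by positivity)]
      linarith
    · apply div_nonneg _ (by positivity)
      have h1 := hthird τ hτ
      have h2 := mul_le_mul_of_nonneg_right (neg_le_abs (thirdForm f (x + τ • u) u v v))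
        (hpos τ hτ).le
      have h3 := mul_le_mul_of_nonneg_right (h2.trans h1) (hpos τ hτ).le
      linarith

/-- The open Dikin ellipsoid at a point of the domain is contained in the domain. -/
theorem add_mem_effDom (hf : IsStandardSelfConcordant f) {x u : Rn n} (hx : x ∈ effDom f)
    (hr : localNorm f x u < 1) : x + u ∈ effDom f := by
  set r := localNorm f x u with hrdef
  have hr0 : 0 ≤ r := localNorm_nonneg f x u
  set C := (r / (1 - r)) ^ 2 with hC
  set p := fderiv ℝ (toRealFun f) x u with hp
  set K := toRealFun f x + (|p| + C) with hK
  have hC0 : 0 ≤ C := by positivity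
  have hhess : ∀ t ∈ Set.Icc (0 : ℝ) 1, x + t • u ∈ effDom f →
      hessForm f (x + t • u) u u ≤ C := by
    intro t ht hxt
    have h1 := (hf.localNorm_line hx ht.1 hxt).1
    rw [← hrdef] at h1
    have h2 : t * r ≤ r := mul_le_of_le_one_left hr0 ht.2
    have h3 : localNorm f (x + t • u) u ≤ r / (1 - r) := by
      rw [le_div_iff₀ (by linarith)]
      exact (mul_le_mul_of_nonneg_left (by linarith) (localNorm_nonneg _ _ _)).trans h1
    rw [← hf.localNorm_sq hxt]
    exact pow_le_pow_left₀ (localNorm_nonneg _ _ _) h3 2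
  have hgrad : ∀ t ∈ Set.Icc (0 : ℝ) 1, x + t • u ∈ effDom f →
      fderiv ℝ (toRealFun f) (x + t • u) u ≤ |p| + C := by
    intro t ht hxt
    have hmem : ∀ τ ∈ Set.Icc 0 t, x + τ • u ∈ effDom f :=
      fun τ hτ => hf.closedConvex.add_smul_mem hx hxt hτ
    have := sub_le_sub_of_hasDerivAt_le (k := fun τ => τ * C) ht.1
      (fun τ hτ => hf.hasDerivAt_fderiv_line (hmem τ hτ) u)
      (fun τ _ => (hasDerivAt_id τ).mul_const C)
      (fun τ hτ => by
        rw [one_mul]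
        exact hhess τ ⟨hτ.1, hτ.2.trans ht.2⟩ (hmem τ hτ))
    simp only [zero_smul, add_zero, zero_mul, sub_zero] at this
    have h1 := le_abs_self p
    have h2 := mul_le_of_le_one_left hC0 ht.2
    linarith
  have hval : ∀ t ∈ Set.Icc (0 : ℝ) 1, x + t • u ∈ effDom f → f (x + t • u) ≤ (K : EReal) := by
    intro t ht hxt
    have hmem : ∀ τ ∈ Set.Icc 0 t, x + τ • u ∈ effDom f :=
      fun τ hτ => hf.closedConvex.add_smul_mem hx hxt hτ
    have := sub_le_sub_of_hasDerivAt_le (k := fun τ => τ * (|p| + C)) ht.1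
      (fun τ hτ => hf.hasDerivAt_line (hmem τ hτ))
      (fun τ _ => (hasDerivAt_id τ).mul_const (|p| + C))
      (fun τ hτ => by
        rw [one_mul]
        exact hgrad τ ⟨hτ.1, hτ.2.trans ht.2⟩ (hmem τ hτ))
    simp only [zero_smul, add_zero, zero_mul, sub_zero] at this
    have h2 := mul_le_of_le_one_left (by positivity : 0 ≤ |p| + C) ht.2
    rw [← hf.closedConvex.coe_toRealFun hxt, EReal.coe_le_coe_iff]
    linarith
  -- Since `f ≤ K` wherever the segment meets the domain, this set is the trace of a sublevel set,
  -- closed by lower semicontinuity. The domain being open, the set is also open in `[0, 1]`, hence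
  -- everything.
  have hclosed : IsClosed ({t : ℝ | x + t • u ∈ effDom f} ∩ Set.Icc 0 1) := by
    have he : {t : ℝ | x + t • u ∈ effDom f} ∩ Set.Icc 0 1 =
        (fun t : ℝ => x + t • u) ⁻¹' (f ⁻¹' Set.Iic (K : EReal)) ∩ Set.Icc 0 1 := by
      ext t
      refine ⟨fun h => ⟨hval t h.2 h.1, h.2⟩, fun h => ⟨?_, h.2⟩⟩
      exact lt_of_le_of_lt h.1 (EReal.coe_lt_top K)
    rw [he]
    exact ((hf.closedConvex.lsc.isClosed_preimage _).preimage (by fun_prop)).inter isClosed_Icc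
  have hall := hclosed.Icc_subset_of_forall_mem_nhdsWithin
    (show (0 : ℝ) ∈ {t : ℝ | x + t • u ∈ effDom f} by simpa using hx)
    (fun t ht => nhdsWithin_le_nhds (hf.eventually_line_mem ht.1))
  simpa using hall (Set.right_mem_Icc.2 zero_le_one)

theorem localNorm_add_le_div (hf : IsStandardSelfConcordant f) {x u : Rn n} (hx : x ∈ effDom f)
    (hr : localNorm f x u < 1) (v : Rn n) :
    localNorm f (x + u) v ≤ localNorm f x v / (1 - localNorm f x u) := by
  have hxu := hf.add_mem_effDom hx hr
  have h := (hf.hessForm_line hx zero_le_one (by simpa using hxu) (by simpa using hr) v).1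
  simp only [one_smul, one_mul] at h
  rw [← hf.localNorm_sq hx, ← hf.localNorm_sq hxu, ← mul_pow] at h
  rw [le_div_iff₀ (by linarith)]
  exact le_of_sq_le_sq h (localNorm_nonneg _ _ _)

theorem localNorm_le_div (hf : IsStandardSelfConcordant f) {x u : Rn n} (hx : x ∈ effDom f)
    (hr : localNorm f x u < 1) (v : Rn n) :
    localNorm f x v ≤ localNorm f (x + u) v / (1 - localNorm f x u) := by
  have hxu := hf.add_mem_effDom hx hr
  have h := (hf.hessForm_line hx zero_le_one (by simpa using hxu) (by simpa using hr) v).2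
  simp only [one_smul, one_mul] at h
  rw [← hf.localNorm_sq hx, ← hf.localNorm_sq hxu, ← mul_pow] at h
  rw [le_div_iff₀ (by linarith)]
  exact le_of_sq_le_sq h (localNorm_nonneg _ _ _)

theorem abs_hessForm_sub_le (hf : IsStandardSelfConcordant f) {x u : Rn n} (hx : x ∈ effDom f)
    {t : ℝ} (ht : 0 ≤ t) (hxt : x + t • u ∈ effDom f) (hr : t * localNorm f x u < 1)
    (v w : Rn n) :
    |hessForm f (x + t • u) v w - hessForm f x v w| ≤
      (((1 - t * localNorm f x u) ^ 2)⁻¹ - 1) * localNorm f x v * localNorm f x w := by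
  set a := t * localNorm f x u with ha
  have ha0 : 0 ≤ a := mul_nonneg ht (localNorm_nonneg _ _ _)
  have hp : 0 < (1 - a) ^ 2 := pow_pos (by linarith) 2
  have hp1 : (1 - a) ^ 2 ≤ 1 := by nlinarith
  have hinv : 1 ≤ ((1 - a) ^ 2)⁻¹ := (one_le_inv₀ hp).2 hp1
  rw [hf.localNorm_eq hx, hf.localNorm_eq hx]
  refine abs_apply_le_of_abs_diag_le (hessForm f (x + t • u) - hessForm f x) (hessForm f x)
    (fun v w => ?_) (hf.hessForm_symm hx) (hf.hessForm_nonneg hx) (by linarith) (fun v => ?_) v w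
  · simp only [sub_apply, hf.hessForm_symm hx v w, hf.hessForm_symm hxt v w]
  · obtain ⟨h1, h2⟩ := hf.hessForm_line hx ht hxt hr v
    rw [← ha] at h1 h2
    have h0 := hf.hessForm_nonneg hx v
    rw [← le_div_iff₀ hp, div_eq_mul_inv] at h1
    -- `y + 1/y ≥ 2`: the decrease `1 - (1 - a)²` is dominated by the increase `(1 - a)⁻² - 1`, so
    -- one constant serves both signs.
    have h3 : 2 ≤ (1 - a) ^ 2 + ((1 - a) ^ 2)⁻¹ := by
      have e := mul_inv_cancel₀ hp.ne'
      nlinarith [sq_nonneg ((1 - a) ^ 2 - 1), inv_pos.2 hp]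
    have h4 := mul_le_mul_of_nonneg_left h3 h0
    simp only [sub_apply]
    rw [abs_le]
    constructor <;> linarith

theorem abs_fderiv_sub_sub_le (hf : IsStandardSelfConcordant f) {x u : Rn n} (hx : x ∈ effDom f)
    (hr : localNorm f x u < 1) (w : Rn n) :
    |fderiv ℝ (toRealFun f) (x + u) w - fderiv ℝ (toRealFun f) x w - hessForm f x u w| ≤
      localNorm f x u ^ 2 / (1 - localNorm f x u) * localNorm f x w := by
  have hxu := hf.add_mem_effDom hx hr
  have hmem : ∀ τ ∈ Set.Icc (0 : ℝ) 1, x + τ • u ∈ effDom f :=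
    fun τ hτ => hf.closedConvex.add_smul_mem hx (by simpa using hxu) hτ
  set r := localNorm f x u with hrdef
  have hr0 : 0 ≤ r := localNorm_nonneg f x u
  have hτr : ∀ τ ∈ Set.Icc (0 : ℝ) 1, τ * r < 1 := fun τ hτ =>
    (mul_le_of_le_one_left hr0 hτ.2).trans_lt hr
  set m := localNorm f x w with hm
  -- `k` is an antiderivative of `((1 - τr)⁻² - 1) r m`, the bound on the Hessian difference.
  have := abs_sub_le_sub_of_hasDerivAt_le
    (h := fun τ => fderiv ℝ (toRealFun f) (x + τ • u) w - τ * hessForm f x u w)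
    (k := fun τ => ((1 - τ * r)⁻¹ - τ * r) * m) zero_le_one
    (fun τ hτ => (hf.hasDerivAt_fderiv_line (hmem τ hτ) w).sub
      ((hasDerivAt_id τ).mul_const (hessForm f x u w)))
    (fun τ hτ => (((((hasDerivAt_id τ).mul_const r).const_sub 1).inv
      (by have := hτr τ hτ; simp only [id]; linarith)).sub
        ((hasDerivAt_id τ).mul_const r)).mul_const m)
    (fun τ hτ => ?_)
  · simp only [zero_smul, add_zero, zero_mul, sub_zero, one_smul, one_mul, inv_one] at this
    have e : ((1 - r)⁻¹ - r) * m - m = r ^ 2 / (1 - r) * m := by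
      have : 1 - r ≠ 0 := by linarith
      field_simp
      ring
    rw [e] at this
    convert this using 2
    ring
  · have h := hf.abs_hessForm_sub_le hx hτ.1 (hmem τ hτ) (hτr τ hτ) u w
    rw [one_mul]
    refine h.trans_eq ?_
    have : 1 - τ * r ≠ 0 := by linarith [hτr τ hτ]
    simp only [id, one_mul, ← hrdef, ← hm]
    field_simp

theorem div_le_fderiv_sub (hf : IsStandardSelfConcordant f) {x u : Rn n} (hx : x ∈ effDom f)
    (hxu : x + u ∈ effDom f) :
    localNorm f x u ^ 2 / (1 + localNorm f x u) ≤
      fderiv ℝ (toRealFun f) (x + u) u - fderiv ℝ (toRealFun f) x u := by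
  have hmem : ∀ τ ∈ Set.Icc (0 : ℝ) 1, x + τ • u ∈ effDom f :=
    fun τ hτ => hf.closedConvex.add_smul_mem hx (by simpa using hxu) hτ
  set r := localNorm f x u with hrdef
  have hr0 : 0 ≤ r := localNorm_nonneg f x u
  have hpos : ∀ τ ∈ Set.Icc (0 : ℝ) 1, 0 < 1 + τ * r := fun τ hτ => by
    have := mul_nonneg hτ.1 hr0
    linarith
  -- The comparison function has derivative `(r/(1 + τr))²`, the lower growth bound for the squared
  -- local norm of `u`.
  have := sub_le_sub_of_hasDerivAt_le
    (h := fun τ => (1 + τ * r)⁻¹ * (-r)) zero_le_one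
    (fun τ hτ => ((((hasDerivAt_id τ).mul_const r).const_add 1).inv (hpos τ hτ).ne').mul_const (-r))
    (fun τ hτ => hf.hasDerivAt_fderiv_line (hmem τ hτ) u)
    (fun τ hτ => ?_)
  · simp only [zero_smul, add_zero, zero_mul, one_smul, one_mul, inv_one] at this
    refine le_of_eq_of_le ?_ this
    have : 1 + r ≠ 0 := by linarith
    field_simp
    ring
  · have h := (hf.localNorm_line hx hτ.1 (hmem τ hτ)).2
    have hp := hpos τ hτ
    rw [← hf.localNorm_sq (hmem τ hτ)]
    rw [← hrdef, ← div_le_iff₀ hp] at h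
    have h2 := pow_le_pow_left₀ (by positivity) h 2
    refine le_of_eq_of_le ?_ h2
    simp only [id, one_mul]
    field_simp

end IsStandardSelfConcordant

/-! ### Optimality conditions -/

section Optimality

variable {n : ℕ} {f g : Rn n → EReal}

theorem mem_effDom_add_iff (hf : ∀ x, f x ≠ ⊥) (hg : ∀ x, g x ≠ ⊥) {x : Rn n} :
    x ∈ effDom (f + g) ↔ x ∈ effDom f ∧ x ∈ effDom g := by
  simp only [effDom, Set.mem_ofPred_eq, Pi.add_apply]
  constructor
  · intro h
    constructor
    · by_contra hx
      rw [not_lt_top_iff.1 hx, EReal.top_add_of_ne_bot (hg x)] at h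
      exact lt_irrefl _ h
    · by_contra hx
      rw [not_lt_top_iff.1 hx, EReal.add_top_of_ne_bot (hf x)] at h
      exact lt_irrefl _ h
  · rintro ⟨h1, h2⟩
    exact EReal.add_lt_top h1.ne h2.ne

theorem nonneg_of_hasDerivAt_of_eventually_le {ψ : ℝ → ℝ} {c : ℝ} (hψ : HasDerivAt ψ c 0)
    (hle : ∀ᶠ t in 𝓝[>] (0 : ℝ), ψ 0 ≤ ψ t) : 0 ≤ c := by
  have h := (hasDerivAt_iff_tendsto_slope.1 hψ).mono_left
    (nhdsWithin_mono (0 : ℝ) (show Set.Ioi (0 : ℝ) ⊆ {0}ᶜ from fun t ht => ne_of_gt ht))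
  refine ge_of_tendsto h ?_
  filter_upwards [hle, self_mem_nhdsWithin] with t h1 h2
  rw [slope_def_field]
  have h2' : (0 : ℝ) < t := h2
  exact div_nonneg (by linarith) (by linarith)

/-- First-order optimality condition for the sum of a convex and a differentiable function. -/
theorem IsProperClosedConvex.le_add_of_isLocalMin (hg : IsProperClosedConvex g) {φ : Rn n → ℝ}
    {φ' : Rn n →L[ℝ] ℝ} {s : Rn n} (hφ : HasFDerivAt φ φ' s) (hs : s ∈ effDom g)
    (hmin : ∀ᶠ y in 𝓝 s, y ∈ effDom g → toRealFun g s + φ s ≤ toRealFun g y + φ y)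
    {y : Rn n} (hy : y ∈ effDom g) : toRealFun g s ≤ toRealFun g y + φ' (y - s) := by
  have hline := hasDerivAt_add_smul s (y - s) 0
  have hφ0 : HasFDerivAt φ φ' ((fun τ : ℝ => s + τ • (y - s)) 0) := by simpa using hφ
  have hd : HasDerivAt (fun t : ℝ => φ (s + t • (y - s)) + t * (toRealFun g y - toRealFun g s))
      (φ' (y - s) + 1 * (toRealFun g y - toRealFun g s)) 0 :=
    (hφ0.comp_hasDerivAt 0 hline).add ((hasDerivAt_id (0 : ℝ)).mul_const _)
  have htend : Filter.Tendsto (fun τ : ℝ => s + τ • (y - s)) (𝓝 0) (𝓝 s) := by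
    simpa using hline.continuousAt.tendsto
  -- Convexity lets the chord of `g` replace `g` on the segment, so the differentiable function in
  -- `hd` has a one-sided minimum at `0`.
  have := nonneg_of_hasDerivAt_of_eventually_le hd (by
    filter_upwards [(htend.eventually hmin).filter_mono nhdsWithin_le_nhds,
      Ioc_mem_nhdsGT (zero_lt_one (α := ℝ))] with t h1 h2
    have he : s + t • (y - s) = (1 - t) • s + t • y := by
      rw [smul_sub, sub_smul, one_smul]
      abel
    have h3 := hg.convexOn.1 hs hy (sub_nonneg.2 h2.2) h2.1.le (by ring)
    have h4 := hg.convexOn.2 hs hy (sub_nonneg.2 h2.2) h2.1.le (by ring)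
    rw [← he] at h3 h4
    have h5 := h1 h3
    simp only [smul_eq_mul] at h4
    simp only [zero_smul, add_zero, zero_mul]
    linarith)
  linarith

theorem mem_effDom_of_mem_proxSet (hg : IsProperClosedConvex g) {H : Rn n →L[ℝ] Rn n}
    {u s : Rn n} (hs : s ∈ proxSet g H u) : s ∈ effDom g := by
  obtain ⟨y, hy⟩ := hg.nonempty
  by_contra h
  have hs' : g s = ⊤ := not_lt_top_iff.1 h
  have h1 := hs y
  rw [hs', EReal.top_add_of_ne_bot (EReal.coe_ne_bot _), top_le_iff] at h1
  exact (EReal.add_lt_top (ne_of_lt hy) (EReal.coe_ne_top _)).ne h1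

/-- Subgradient inclusion for the subproblem, in variational form, so that two such inequalities can
be added and `g` cancels. -/
theorem le_of_mem_proxSet (hf : IsStandardSelfConcordant f) (hg : IsProperClosedConvex g)
    {x s : Rn n} (hx : x ∈ effDom f) (hs : s ∈ proxSet g (hess f x) (hess f x x - grad f x))
    {y : Rn n} (hy : y ∈ effDom g) :
    toRealFun g s ≤ toRealFun g y +
      (fderiv ℝ (toRealFun f) x (y - s) + hessForm f x (s - x) (y - s)) := by
  have hsg := mem_effDom_of_mem_proxSet hg hs
  have hq : ∀ y, 1 / 2 * ⟪y, hess f x y⟫ - ⟪hess f x x - grad f x, y⟫ =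
      1 / 2 * hessForm f x y y - hessForm f x x y + fderiv ℝ (toRealFun f) x y := by
    intro y
    rw [inner_sub_left, inner_grad, hf.inner_hess hx, real_inner_comm y, hf.inner_hess hx]
    ring
  have hd := ((((hessForm f x).hasFDerivAt (x := s)).clm_apply (hasFDerivAt_id s)).const_mul
    (1 / 2 : ℝ)).sub ((hessForm f x x).hasFDerivAt (x := s))
  have hd' := hd.add ((fderiv ℝ (toRealFun f) x).hasFDerivAt (x := s))
  have := hg.le_add_of_isLocalMin hd' hsg (Filter.Eventually.of_forall fun y hy => ?_) hy
  · refine this.trans_eq ?_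
    congr 1
    simp [hf.hessForm_symm hx _ s]
    ring
  · have h := hs y
    rw [← hg.coe_toRealFun hsg, ← hg.coe_toRealFun hy, hq, hq] at h
    norm_cast at h

theorem IsSolution.le_add (hf : IsStandardSelfConcordant f) (hg : IsProperClosedConvex g)
    {z : Rn n} (hz : IsSolution f g z) {y : Rn n} (hy : y ∈ effDom g) :
    toRealFun g z ≤ toRealFun g y + fderiv ℝ (toRealFun f) z (y - z) := by
  obtain ⟨hzf, hzg⟩ := (mem_effDom_add_iff hf.closedConvex.ne_bot hg.ne_bot).1 hz.1
  refine hg.le_add_of_isLocalMin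
    ((hf.contDiffAt hzf).differentiableAt (by norm_num)).hasFDerivAt hzg ?_ hy
  filter_upwards [hf.isOpen_dom.mem_nhds hzf] with w hwf hwg
  have h := hz.2 w
  simp only [Pi.add_apply] at h
  rw [← hg.coe_toRealFun hzg, ← hg.coe_toRealFun hwg, ← hf.closedConvex.coe_toRealFun hzf,
    ← hf.closedConvex.coe_toRealFun hwf] at h
  norm_cast at h
  linarith

end Optimality

/-! ### One step of the proximal-Newton scheme -/

section Step

variable {n : ℕ} {f g : Rn n → EReal}

theorem localNorm_neg (f : Rn n → EReal) (x v : Rn n) : localNorm f x (-v) = localNorm f x v := by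
  simp [localNorm]

theorem localNorm_sub_comm (f : Rn n → EReal) (x v w : Rn n) :
    localNorm f x (v - w) = localNorm f x (w - v) := by
  rw [← localNorm_neg, neg_sub]

theorem add_smul_mem_effDom_add (hf : IsStandardSelfConcordant f) (hg : IsProperClosedConvex g)
    {x s : Rn n} {α : ℝ} (hα : 0 ≤ α) (hα1 : α ≤ 1) (hx : x ∈ effDom (f + g))
    (hs : s ∈ proxSet g (hess f x) (hess f x x - grad f x))
    (hr : α * localNorm f x (s - x) < 1) : x + α • (s - x) ∈ effDom (f + g) := by
  rw [mem_effDom_add_iff hf.closedConvex.ne_bot hg.ne_bot] at hx ⊢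
  refine ⟨hf.add_mem_effDom hx.1 ?_, hg.convexOn.1.add_smul_sub_mem hx.2
    (mem_effDom_of_mem_proxSet hg hs) ⟨hα, hα1⟩⟩
  rwa [hf.localNorm_smul hx.1, abs_of_nonneg hα]

/-- The sharp estimate for the proximal-Newton decrement after a damped step. -/
theorem decrement_step_le (hf : IsStandardSelfConcordant f) (hg : IsProperClosedConvex g)
    {x s s' : Rn n} {α l : ℝ} (hα : 0 ≤ α) (hα1 : α ≤ 1) (hx : x ∈ effDom f)
    (hl : localNorm f x (s - x) = l) (hr : α * l < 1)
    (hs : s ∈ proxSet g (hess f x) (hess f x x - grad f x))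
    (hs' : s' ∈ proxSet g (hess f (x + α • (s - x)))
      (hess f (x + α • (s - x)) (x + α • (s - x)) - grad f (x + α • (s - x)))) :
    localNorm f (x + α • (s - x)) (s' - (x + α • (s - x))) ≤
      (1 - α + α * (α * l) * (1 - α * l)) / (1 - α * l) ^ 3 * l := by
  set d := s - x with hd
  set z := x + α • d with hz
  have hl0 : 0 ≤ l := hl ▸ localNorm_nonneg _ _ _
  have ha : localNorm f x (α • d) = α * l := by
    rw [hf.localNorm_smul hx, abs_of_nonneg hα, hl]
  have hra : localNorm f x (α • d) < 1 := by rwa [ha]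
  have hzf : z ∈ effDom f := hf.add_mem_effDom hx hra
  set a := α * l with hadef
  have ha0 : 0 ≤ a := mul_nonneg hα hl0
  have hp : 0 < 1 - a := by linarith
  set d' := s' - z with hd'
  set w := d' - (1 - α) • d with hw
  have hws : s' - s = w := by
    rw [hw, hd', hz, hd, sub_smul, one_smul]
    abel
  have m1 := le_of_mem_proxSet hf hg hx hs (mem_effDom_of_mem_proxSet hg hs')
  have m2 := le_of_mem_proxSet hf hg hzf hs' (mem_effDom_of_mem_proxSet hg hs)
  rw [hws, ← hd] at m1
  rw [show s - s' = -w by rw [← hws, neg_sub], ← hd', map_neg, map_neg] at m2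
  have e1 : hessForm f z d' w = hessForm f z w w + (1 - α) * hessForm f z d w := by
    have : d' = w + (1 - α) • d := by rw [hw]; abel
    rw [this]
    simp
  have b1 := (abs_le.1 (hf.abs_fderiv_sub_sub_le hx hra w)).1
  rw [ha, ← hz, map_smul, smul_apply, smul_eq_mul] at b1
  have b2 := (abs_le.1 (hf.abs_hessForm_sub_le hx (t := 1) (u := α • d) zero_le_one
    (by simpa using hzf) (by simpa using hra) d w)).1
  rw [one_smul, one_mul, ha, ← hz, hl] at b2
  set m := localNorm f z w with hm
  have hm0 : 0 ≤ m := localNorm_nonneg _ _ _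
  have hxm : localNorm f x w ≤ m / (1 - a) := by
    have := hf.localNorm_le_div hx hra w
    rwa [ha, ← hz] at this
  have hzd : localNorm f z d ≤ l / (1 - a) := by
    have := hf.localNorm_add_le_div hx hra d
    rwa [ha, ← hz, hl] at this
  set c := a ^ 2 / (1 - a) + (1 - α) * ((((1 - a) ^ 2)⁻¹ - 1) * l) with hc
  have hinv : 1 ≤ ((1 - a) ^ 2)⁻¹ := (one_le_inv₀ (by positivity)).2 (by nlinarith)
  have hc0 : 0 ≤ c := by
    have h1 : 0 ≤ 1 - α := by linarith
    have h2 : 0 ≤ ((1 - a) ^ 2)⁻¹ - 1 := by linarith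
    positivity
  -- Sum of `m1` and `m2`: `D²f(z)[w,w]` is at most the linearization error along `α d` plus `1 - α`
  -- times the Hessian change on `(d, w)`.
  have hsq : m ^ 2 ≤ c * localNorm f x w := by
    rw [hm, hf.localNorm_sq hzf, hc]
    have b2' := mul_le_mul_of_nonneg_left b2 (by linarith : 0 ≤ 1 - α)
    rw [e1] at m2
    nlinarith
  have hmle : m ≤ c / (1 - a) := by
    have h1 : m ^ 2 ≤ c * (m / (1 - a)) := hsq.trans (mul_le_mul_of_nonneg_left hxm hc0)
    rcases hm0.eq_or_lt with h0 | h0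
    · rw [← h0]
      positivity
    · have h2 : m * m ≤ c / (1 - a) * m := by
        calc m * m = m ^ 2 := by ring
          _ ≤ _ := h1
          _ = _ := by ring
      exact le_of_mul_le_mul_right h2 h0
  have htri : localNorm f z d' ≤ m + (1 - α) * (l / (1 - a)) := by
    have : d' = w + (1 - α) • d := by rw [hw]; abel
    rw [this]
    refine (hf.localNorm_add_le hzf _ _).trans ?_
    rw [hf.localNorm_smul hzf, abs_of_nonneg (by linarith : 0 ≤ 1 - α), ← hm]
    have := mul_le_mul_of_nonneg_left hzd (by linarith : 0 ≤ 1 - α)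
    linarith
  -- The `-1` in `c` cancels the triangle-inequality term, leaving `(1 - α) l / (1 - a)³ + a² / (1 -
  -- a)²`.
  refine htri.trans ((add_le_add_left hmle _).trans_eq ?_)
  have hpn : 1 - a ≠ 0 := hp.ne'
  have hal : a ^ 2 = α * a * l := by rw [hadef]; ring
  rw [hc, hal]
  field_simp
  ring

/-- The distance of the subproblem solution to the minimizer is quadratically small in the
decrement. -/
theorem localNorm_sub_solution_le (hf : IsStandardSelfConcordant f) (hg : IsProperClosedConvex g)
    {x s z : Rn n} {l : ℝ} (hx : x ∈ effDom f) (hz : IsSolution f g z)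
    (hs : s ∈ proxSet g (hess f x) (hess f x x - grad f x))
    (hl : localNorm f x (s - x) = l) (hl4 : l ≤ 1 / 4) :
    localNorm f s (z - s) ≤ 2 * l ^ 2 := by
  obtain ⟨hzf, hzg⟩ := (mem_effDom_add_iff hf.closedConvex.ne_bot hg.ne_bot).1 hz.1
  have hl0 : 0 ≤ l := hl ▸ localNorm_nonneg _ _ _
  have hsx : x + (s - x) = s := by abel
  have hr : localNorm f x (s - x) < 1 := by linarith
  have hsf : s ∈ effDom f := by
    have := hf.add_mem_effDom hx hr
    rwa [hsx] at this
  set e := z - s with he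
  set r := localNorm f s e with hrdef
  have hr0 : 0 ≤ r := localNorm_nonneg _ _ _
  have h1 := le_of_mem_proxSet hf hg hx hs hzg
  have h2 := hz.le_add hf hg (mem_effDom_of_mem_proxSet hg hs)
  rw [← he] at h1
  rw [show s - z = -e by rw [he, neg_sub], map_neg] at h2
  have h3 := hf.div_le_fderiv_sub (u := e) hsf (by rw [he]; simpa using hzf)
  rw [show s + e = z by rw [he]; abel, ← hrdef] at h3
  have h4 := (abs_le.1 (hf.abs_fderiv_sub_sub_le hx hr e)).1
  rw [hsx, hl] at h4
  have h5 := hf.localNorm_le_div hx hr e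
  rw [hsx, hl, ← hrdef] at h5
  have hp : 0 < 1 - l := by linarith
  have h6 : l ^ 2 / (1 - l) * localNorm f x e ≤ 16 / 9 * l ^ 2 * r := by
    calc l ^ 2 / (1 - l) * localNorm f x e ≤ l ^ 2 / (1 - l) * (r / (1 - l)) := by gcongr
      _ ≤ l ^ 2 / (3 / 4) * (r / (3 / 4)) := by
        gcongr <;> linarith
      _ = _ := by ring
  -- Adding `h1` and `h2` bounds the monotonicity gap of the gradient between `s` and `z` by the
  -- linearization error at `s`. The constant `16/9` is `(1 - l)⁻²` at `l = 1/4`.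
  have h7 : r ^ 2 / (1 + r) ≤ 16 / 9 * l ^ 2 * r := by linarith
  rw [div_le_iff₀ (by linarith)] at h7
  rcases hr0.eq_or_lt with h0 | h0
  · rw [← h0]
    positivity
  · have h8 : r ≤ 16 / 9 * l ^ 2 * (1 + r) := by
      refine le_of_mul_le_mul_right ?_ h0
      linarith
    have h9 : l ^ 2 ≤ 1 / 16 := by nlinarith
    nlinarith

end Step

/-! ### Convergence of the proximal-Newton scheme -/

section Convergence

variable {n : ℕ} {f g : Rn n → EReal} {x s : ℕ → Rn n} {α : ℕ → ℝ}

theorem IsProxNewtonSeq.succ_mem (hf : IsStandardSelfConcordant f) (hg : IsProperClosedConvex g)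
    (hseq : IsProxNewtonSeq f g x s α) {k : ℕ} (hx : x k ∈ effDom (f + g))
    (hr : α k * decrement f x s k < 1) : x (k + 1) ∈ effDom (f + g) := by
  rw [hseq.update k]
  exact add_smul_mem_effDom_add hf hg (hseq.step_pos k).le (hseq.step_le_one k) hx
    (hseq.subproblem k) hr

theorem IsProxNewtonSeq.decrement_succ_le (hf : IsStandardSelfConcordant f)
    (hg : IsProperClosedConvex g) (hseq : IsProxNewtonSeq f g x s α) {k : ℕ}
    (hx : x k ∈ effDom (f + g)) (hr : α k * decrement f x s k < 1) :
    decrement f x s (k + 1) ≤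
      (1 - α k + α k * (α k * decrement f x s k) * (1 - α k * decrement f x s k)) /
        (1 - α k * decrement f x s k) ^ 3 * decrement f x s k := by
  have hxf := ((mem_effDom_add_iff hf.closedConvex.ne_bot hg.ne_bot).1 hx).1
  have hs' := hseq.subproblem (k + 1)
  rw [hseq.update k] at hs'
  have := decrement_step_le hf hg (hseq.step_pos k).le (hseq.step_le_one k) hxf rfl hr
    (hseq.subproblem k) hs'
  rwa [← hseq.update k] at this

/-- The iterates approach the minimizer quadratically as long as `1 - α k` is of the order of the
decrement. -/
theorem IsProxNewtonSeq.localNorm_succ_le (hf : IsStandardSelfConcordant f)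
    (hg : IsProperClosedConvex g) (hseq : IsProxNewtonSeq f g x s α) {z : Rn n}
    (hz : IsSolution f g z) {k : ℕ} (hx : x k ∈ effDom (f + g)) (hl4 : decrement f x s k ≤ 1 / 4)
    (hα : 1 - α k ≤ decrement f x s k) :
    localNorm f z (x (k + 1) - z) ≤ 4 * decrement f x s k ^ 2 ∧
      decrement f x s k ≤ 5 * localNorm f z (x k - z) := by
  have hxf := ((mem_effDom_add_iff hf.closedConvex.ne_bot hg.ne_bot).1 hx).1
  have hzf := ((mem_effDom_add_iff hf.closedConvex.ne_bot hg.ne_bot).1 hz.1).1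
  have hα1 := hseq.step_le_one k
  have hup := hseq.update k
  have hsol := localNorm_sub_solution_le hf hg hxf hz (hseq.subproblem k) rfl hl4
  change localNorm f (s k) (z - s k) ≤ 2 * decrement f x s k ^ 2 at hsol
  set l := decrement f x s k with hl
  have hl' : localNorm f (x k) (s k - x k) = l := rfl
  have hl0 : 0 ≤ l := localNorm_nonneg _ _ _
  have hl2 : l ^ 2 ≤ 1 / 4 * l := by nlinarith
  have hr : localNorm f (x k) (s k - x k) < 1 := by linarith
  have hsf : s k ∈ effDom f := by simpa using hf.add_mem_effDom hxf hr
  have hr' : localNorm f (s k) (z - s k) ≤ 1 / 8 := by nlinarith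
  have hr1 : localNorm f (s k) (z - s k) < 1 := by linarith
  -- The norms at `x k`, `s k` and `z` are comparable: `8/7 = 1/(1 - 1/8)` between `s k` and `z`,
  -- `4/3 = 1/(1 - 1/4)` between `x k` and `s k`.
  have hzs : ∀ v, localNorm f z v ≤ 8 / 7 * localNorm f (s k) v := by
    intro v
    have h := hf.localNorm_add_le_div hsf hr1 v
    rw [add_sub_cancel, le_div_iff₀ (by linarith)] at h
    nlinarith [localNorm_nonneg f z v]
  have hsz : ∀ v, localNorm f (s k) v ≤ 8 / 7 * localNorm f z v := by
    intro v
    have h := hf.localNorm_le_div hsf hr1 v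
    rw [add_sub_cancel, le_div_iff₀ (by linarith)] at h
    nlinarith [localNorm_nonneg f (s k) v]
  have hsx : ∀ v, localNorm f (s k) v ≤ 4 / 3 * localNorm f (x k) v := by
    intro v
    have h := hf.localNorm_add_le_div hxf hr v
    rw [add_sub_cancel, hl', le_div_iff₀ (by linarith)] at h
    nlinarith [localNorm_nonneg f (s k) v]
  have hxs : ∀ v, localNorm f (x k) v ≤ 4 / 3 * localNorm f (s k) v := by
    intro v
    have h := hf.localNorm_le_div hxf hr v
    rw [add_sub_cancel, hl', le_div_iff₀ (by linarith)] at h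
    nlinarith [localNorm_nonneg f (x k) v]
  constructor
  · have he : x (k + 1) - z = (s k - z) + (-(1 - α k)) • (s k - x k) := by
      rw [hup, neg_smul, sub_smul, one_smul]
      abel
    have h1 := hf.localNorm_add_le hzf (s k - z) ((-(1 - α k)) • (s k - x k))
    rw [hf.localNorm_smul hzf, abs_neg, abs_of_nonneg (by linarith : 0 ≤ 1 - α k),
      localNorm_sub_comm f z (s k) z] at h1
    have h2 := hzs (z - s k)
    have h3 : localNorm f z (s k - x k) ≤ 32 / 21 * l := by
      have h4 := hzs (s k - x k)
      have h5 := hsx (s k - x k)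
      linarith
    have h4 : (1 - α k) * localNorm f z (s k - x k) ≤ l * (32 / 21 * l) :=
      mul_le_mul hα h3 (localNorm_nonneg _ _ _) hl0
    rw [he]
    -- `8/7 · 2 + 32/21 = 80/21 < 4`.
    nlinarith
  · have he : s k - x k = (s k - z) + (z - x k) := by abel
    have h1 := hf.localNorm_add_le hxf (s k - z) (z - x k)
    rw [← he, hl', localNorm_sub_comm f (x k) (s k) z, localNorm_sub_comm f (x k) z (x k)] at h1
    have h2 := hxs (z - s k)
    have h3 := hxs (x k - z)
    have h4 := hsz (x k - z)
    have h5 := localNorm_nonneg f z (x k - z)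
    -- Since `l² ≤ l/4`, the term `4/3 · 2l²` is at most `2l/3` and is absorbed, leaving the factor
    -- `32/7 < 5`.
    linarith

theorem IsProxNewtonSeq.converges (hf : IsStandardSelfConcordant f)
    (hg : IsProperClosedConvex g) (hseq : IsProxNewtonSeq f g x s α) {z : Rn n}
    (hz : IsSolution f g z) (h0 : decrement f x s 0 ≤ 1 / 4)
    (hα : ∀ k, 1 - α k ≤ decrement f x s k)
    (hquad : ∀ k, x k ∈ effDom (f + g) → decrement f x s k ≤ 1 / 4 →
      decrement f x s (k + 1) ≤ 3 * decrement f x s k ^ 2) :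
    (∀ k, x k ∈ effDom (f + g)) ∧ ConvergesQuadratically (decrement f x s) ∧
      ConvergesQuadratically (fun k => localNorm f z (x k - z)) := by
  have hnn : ∀ k, 0 ≤ decrement f x s k := fun k => localNorm_nonneg _ _ _
  have key : ∀ k, x k ∈ effDom (f + g) ∧ decrement f x s k ≤ 1 / 4 * (3 / 4) ^ k ∧
      decrement f x s k ≤ 1 / 4 := by
    intro k
    induction k with
    | zero => exact ⟨hseq.init, by simpa using h0, h0⟩
    | succ k ih =>
      obtain ⟨hx, h1, h2⟩ := ih
      have hn := hnn k
      have hq := hquad k hx h2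
      have hr : α k * decrement f x s k < 1 := by
        have := mul_le_of_le_one_left hn (hseq.step_le_one k)
        linarith
      have h3 : decrement f x s (k + 1) ≤ 3 / 4 * decrement f x s k := by nlinarith
      refine ⟨hseq.succ_mem hf hg hx hr, ?_, by linarith⟩
      rw [pow_succ]
      linarith
  have hlim : Filter.Tendsto (decrement f x s) Filter.atTop (𝓝 0) := by
    have h := (tendsto_pow_atTop_nhds_zero_of_lt_one (r := (3 / 4 : ℝ)) (by norm_num)
      (by norm_num)).const_mul (1 / 4)
    rw [mul_zero] at h
    exact squeeze_zero hnn (fun k => (key k).2.1) h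
  have hstep := fun k => hseq.localNorm_succ_le hf hg hz (key k).1 (key k).2.2 (hα k)
  -- `100 = 4 · 5²`, chaining the two bounds of `localNorm_succ_le`.
  refine ⟨fun k => (key k).1, ⟨hlim, 3, fun k => hquad k (key k).1 (key k).2.2⟩, ?_, 100,
    fun k => ?_⟩
  · rw [← Filter.tendsto_add_atTop_iff_nat 1]
    have h := (hlim.pow 2).const_mul 4
    simp only [ne_eq, OfNat.ofNat_ne_zero, not_false_eq_true, zero_pow, mul_zero] at h
    exact squeeze_zero (fun k => localNorm_nonneg _ _ _) (fun k => (hstep k).1) h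
  · obtain ⟨h1, h2⟩ := hstep k
    have h3 := pow_le_pow_left₀ (hnn k) h2 2
    rw [mul_pow] at h3
    linarith

end Convergence

/-! ### Scalar rate comparison and the main theorem -/

theorem damped_rate_le {α l : ℝ} (hα : 0 ≤ α) (hα1 : α ≤ 1) (hl : 0 ≤ l)
    (h : α * l < 1 - 1 / √2) :
    (1 - α + α * (α * l) * (1 - α * l)) / (1 - α * l) ^ 3 * l ≤
      (1 - α + (2 * α ^ 2 - α) * l) / (1 - 4 * α * l + 2 * α ^ 2 * l ^ 2) * l := by
  set a := α * l with ha
  have ha0 : 0 ≤ a := mul_nonneg hα hl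
  have hw : 0 < 1 / √2 := by positivity
  have hw2 : (1 / √2) ^ 2 = (1 / 2 : ℝ) := by
    rw [div_pow, one_pow, Real.sq_sqrt (by norm_num)]
  have hp : 0 < 1 - a := by linarith
  have hD : 0 < 1 - 4 * α * l + 2 * α ^ 2 * l ^ 2 := by
    have : 1 - 4 * α * l + 2 * α ^ 2 * l ^ 2 = 2 * (1 - a) ^ 2 - 1 := by rw [ha]; ring
    rw [this]
    nlinarith
  have eD : 1 - 4 * α * l + 2 * α ^ 2 * l ^ 2 = 1 - 4 * a + 2 * a ^ 2 := by rw [ha]; ring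
  have eN : 1 - α + (2 * α ^ 2 - α) * l = (1 - α) * (1 - a) + α * a := by rw [ha]; ring
  rw [eD] at hD ⊢
  rw [eN]
  refine mul_le_mul_of_nonneg_right ?_ hl
  rw [div_le_div_iff₀ (by positivity) hD]
  -- The denominator is `2(1 - a)² - 1`, positive exactly because `a < 1 - 1/√2`; with `y = (1 -
  -- a)²`, `y² - (2y - 1) = (y - 1)²`.
  have h4 : 1 - 4 * a + 2 * a ^ 2 ≤ (1 - a) ^ 4 := by nlinarith [sq_nonneg (a * (2 - a))]
  have h2 : 1 - 4 * a + 2 * a ^ 2 ≤ (1 - a) ^ 2 := by nlinarith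
  have e1 := mul_le_mul_of_nonneg_left h4 (by linarith : 0 ≤ 1 - α)
  have e2 := mul_le_mul_of_nonneg_left h2 (by positivity : 0 ≤ α * a * (1 - a))
  linarith

theorem mainTheorem1 {n : ℕ} (f g : Rn n → EReal)
    (hf : IsStandardSelfConcordant f) (hg : IsProperClosedConvex g)
    (xstar : Rn n) (hsol : IsSolution f g xstar)
    (huniq : ∀ y, IsSolution f g y → y = xstar)
    (hreg : IsStronglyRegular f xstar)
    (x s : ℕ → Rn n) (α : ℕ → ℝ) (hseq : IsProxNewtonSeq f g x s α) :
    (∀ k, x k ∈ effDom (f + g) → α k * decrement f x s k < 1 - 1 / √2 →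
      x (k + 1) ∈ effDom (f + g) ∧
      decrement f x s (k + 1) ≤
        (1 - α k + (2 * α k ^ 2 - α k) * decrement f x s k) /
          (1 - 4 * α k * decrement f x s k + 2 * α k ^ 2 * decrement f x s k ^ 2) *
          decrement f x s k) ∧
    ((∀ k, α k = (1 + decrement f x s k)⁻¹) → decrement f x s 0 ≤ √5 - 2 →
      (∀ k, x k ∈ effDom (f + g)) ∧
      ConvergesQuadratically (decrement f x s) ∧
      ConvergesQuadratically (fun k => localNorm f xstar (x k - xstar))) ∧
    ((∀ k, α k = 1) → decrement f x s 0 ≤ (5 - √17) / 4 →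
      (∀ k, x k ∈ effDom (f + g)) ∧
      ConvergesQuadratically (decrement f x s) ∧
      ConvergesQuadratically (fun k => localNorm f xstar (x k - xstar))) := by
  have hnn : ∀ k, 0 ≤ decrement f x s k := fun k => localNorm_nonneg _ _ _
  refine ⟨fun k hx hr => ?_, fun hα h0 => ?_, fun hα h0 => ?_⟩
  · have hr1 : α k * decrement f x s k < 1 := by
      have : 0 < 1 / √2 := by positivity
      linarith
    exact ⟨hseq.succ_mem hf hg hx hr1, (hseq.decrement_succ_le hf hg hx hr1).trans
      (damped_rate_le (hseq.step_pos k).le (hseq.step_le_one k) (hnn k) hr)⟩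
  · have h5 : √5 ≤ 9 / 4 := Real.sqrt_le_iff.2 ⟨by norm_num, by norm_num⟩
    refine hseq.converges hf hg hsol (by linarith) (fun k => ?_) (fun k hx hl4 => ?_)
    · have hl := hnn k
      have hp : 0 < 1 + decrement f x s k := by linarith
      have e : 1 - (1 + decrement f x s k)⁻¹ = decrement f x s k / (1 + decrement f x s k) := by
        field_simp
        ring
      rw [hα k, e]
      exact div_le_self hl (by linarith)
    · have hl := hnn k
      have hr : α k * decrement f x s k < 1 := by
        have := mul_le_of_le_one_left hl (hseq.step_le_one k)
        linarith
      refine (hseq.decrement_succ_le hf hg hx hr).trans ?_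
      rw [hα k]
      set l := decrement f x s k
      have hp : 1 + l ≠ 0 := by linarith
      -- Here `1 - α l = α`. For `l ≤ 1/4` the resulting factor `(1 + l)² + 1` is at most `41/16 <
      -- 3`.
      have e : (1 - (1 + l)⁻¹ + (1 + l)⁻¹ * ((1 + l)⁻¹ * l) * (1 - (1 + l)⁻¹ * l)) /
          (1 - (1 + l)⁻¹ * l) ^ 3 * l = ((1 + l) ^ 2 + 1) * l ^ 2 := by
        have : 1 - (1 + l)⁻¹ * l = (1 + l)⁻¹ := by
          field_simp
          ring
        rw [this]
        field_simp
        ring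
      rw [e]
      refine mul_le_mul_of_nonneg_right ?_ (sq_nonneg l)
      nlinarith
  · have h17 : 4 ≤ √17 := Real.le_sqrt_of_sq_le (by norm_num)
    refine hseq.converges hf hg hsol (by linarith) (fun k => ?_) (fun k hx hl4 => ?_)
    · rw [hα k, sub_self]
      exact hnn k
    · have hl := hnn k
      refine (hseq.decrement_succ_le hf hg hx (by rw [hα k, one_mul]; linarith)).trans ?_
      rw [hα k]
      set l := decrement f x s k
      have hp : 0 < 1 - l := by linarith
      have e : (1 - 1 + 1 * (1 * l) * (1 - 1 * l)) / (1 - 1 * l) ^ 3 * l = l ^ 2 / (1 - l) ^ 2 := by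
        simp only [one_mul, sub_self, zero_add]
        field_simp
      rw [e, div_le_iff₀ (by positivity)]
      nlinarith [mul_nonneg (sq_nonneg l) (by nlinarith : 0 ≤ 3 * (1 - l) ^ 2 - 1)]
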